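/- **Conventions.** A structure is \emph{ultrahomogeneous} if each isomorphism between finitely generated substructures extends to an automorphism; a countable structure is \emph{$\omega$-categorical} if it is infinite and its complete theory has, up to isomorphism, exactly one countably infinite model. The \emph{age} of $M$ is the class of finitely generated structures embeddable in $M$, and a class $\mathcal K$ of structures has \emph{strong amalgamation} if for all embeddings $f_0 : A \to B_0$, $f_1 : A \to B_1$ in $\mathcal K$ there are $C \in \mathcal K$ and embeddings $g_i : B_i \to C$ with $g_0 f_0 = g_1 f_1$ and $g_0(B_0) \cap g_1(B_1) = g_0 f_0(A)$. For $k \ge 1$, an infinite structure $M$ has the \emph{infinite $k$-sunflower property} if every structure $M' \cong M$ whose elements are sets of size $k$ has a substructure $T \cong M$ such that, for some set $c$, $v \cap v' = c$ for all distinct $v, v' \in T$; it has the \emph{infinite sunflower property} if this holds for all $k \geq 1$. A relational structure $M$ has the \emph{galah property} if for each partition $(C, D)$ of its domain, $C \cong M$ or $D$ contains a copy of $M$. It is \emph{locally replicable} if every non-empty open set contains a copy of $M$, in the topology with basic open sets $\{v \in M : \mathrm{qftp}(v/A) = \mathrm{qftp}(b/A)\}$ for $A \subseteq M$ a finite substructure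 and $b \in M \setminus A$, where $\mathrm{qftp}$ denotes the quantifier-free type. A finite meet-semilattice (possibly empty) is regarded as a structure in the language $\{<, \wedge\}$, with $<$ a binary relation symbol and $\wedge$ a binary function symbol. For a structure $M$, $\mathrm{Can}(M)$ is the relational structure with the same domain as $M$ which, for each $n \geq 1$ and each quantifier-free type $p$ of an $n$-tuple of $M$, has an $n$-ary relation $R_p$ consisting of the $n$-tuples of $M$ with quantifier-free type $p$. **Proposition.** The class of finite meet-semilattices has a (countable) Fraïssé limit $\mathbb{S}$, the generic meet-semilattice. Its canonical structure $\mathrm{Can}(\mathbb{S})$ is a countably infinite, $\omega$-categorical, ultrahomogeneous relational structure which has the infinite sunflower property, but the age of $\mathrm{Can}(\mathbb{S})$ does not have strong amalgamation. Moreover $\mathrm{Can}(\mathbb{S})$ neither has the galah property nor is locally replicable. Consequently the following five properties of a structure $M$ are not all equivalent for $M = \mathrm{Can}(\mathbb{S})$, and hence not for all relational countable ultrahomogeneous structures (without the assumption of strong amalgamation on the age): (i) the infinite sunflower property; (ii) the infinite $2$-sunflower property; (iii) for every colouring $\chi : M \to \omega$ there is a copy of $M$ inside $M$ on which $\chi$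 is constant or injective; (iv) the galah property; (v) local replicability. -/

import Mathlib

open CategoryTheory (Bundled)
open scoped FirstOrder Cardinal Topology

namespace Sunflower

universe u v w

section General

variable (L : FirstOrder.Language.{u, v}) (M : Type w) [L.Structure M]

/-- The set `U` contains a copy of `M`: some substructure of `M` with domain inside `U` is
isomorphic to `M`. -/
def ContainsCopy (U : Set M) : Prop :=
  ∃ T : L.Substructure M, (T : Set M) ⊆ U ∧ Nonempty (M ≃[L] T)

/-- The infinite `k`-sunflower property: every structure `V` on `k`-sets which is isomorphic to `M`
has a substructure isomorphic to `M` any two distinct elements of which have the same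
intersection `c`. -/
def InfiniteKSunflowerProperty (k : ℕ) : Prop :=
  ∀ (X : Type w) (V : Set (Finset X)) [L.Structure V],
    (∀ s ∈ V, s.card = k) → Nonempty (M ≃[L] V) →
      ∃ T : L.Substructure V, Nonempty (M ≃[L] T) ∧
        ∃ c : Set X, ∀ s ∈ T, ∀ t ∈ T, s ≠ t →
          ((s : Finset X) : Set X) ∩ ((t : Finset X) : Set X) = c

/-- The infinite sunflower property (for an infinite structure `M`). -/
def InfiniteSunflowerProperty : Prop :=
  ∀ k : ℕ, 0 < k → InfiniteKSunflowerProperty L M k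

/-- Every colouring of `M` by natural numbers admits a monochromatic copy of `M` or a copy of `M`
all of whose elements have different colours. -/
def MonochromaticOrHeterochromatic : Prop :=
  ∀ χ : M → ℕ, ∃ T : L.Substructure M, Nonempty (M ≃[L] T) ∧
    ((∀ x ∈ T, ∀ y ∈ T, χ x = χ y) ∨ Set.InjOn χ (T : Set M))

/-- The galah property of a relational structure: for each partition `(C, Cᶜ)` of the vertices,
`C` is isomorphic to `M` or `Cᶜ` contains a copy of `M`. -/
def GalahProperty [L.IsRelational] : Prop :=
  ∀ C : Set M, (∃ T : L.Substructure M, (T : Set M) = C ∧ Nonempty (M ≃[L] T)) ∨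
    ContainsCopy L M Cᶜ

variable {M}

/-- The quantifier-free type of a tuple. -/
def qfType {α : Type*} (a : α → M) : Set (L.Formula α) :=
  {φ | FirstOrder.Language.BoundedFormula.IsQF φ ∧ φ.Realize a}

/-- The quantifier-free type of an element `x` over a set `A` of parameters. -/
def qfTypeOver (A : Set M) (x : M) : Set (L.Formula (A ⊕ Unit)) :=
  qfType L (Sum.elim (fun a : A => (a : M)) (fun _ : Unit => x))

variable (M)

/-- The topology whose basic open sets are the sets of realisations of quantifier-free types
of elements outside `A` over `A`, for `A` a finite substructure. -/
@[reducible]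
def qfTopology : TopologicalSpace M :=
  TopologicalSpace.generateFrom
    {U | ∃ A : L.Substructure M, (A : Set M).Finite ∧ ∃ b : M, b ∉ A ∧
      U = {x | qfTypeOver L (A : Set M) x = qfTypeOver L (A : Set M) b}}

/-- Local replicability: each non-empty open set contains a copy of `M`. -/
def LocallyReplicable : Prop :=
  ∀ U : Set M, IsOpen[qfTopology L M] U → U.Nonempty → ContainsCopy L M U

/-- `M` is `ω`-categorical: it is countably infinite, and any two countably infinite models of its
complete theory are isomorphic. -/
def OmegaCategorical : Prop :=
  #M = ℵ₀ ∧ (ℵ₀ : Cardinal.{w}).Categorical (L.completeTheory M)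

variable {L} in
/-- Strong amalgamation for a class of structures: the two extensions can be amalgamated so that
their images meet only in the image of the common part. -/
def StrongAmalgamation (K : Set (Bundled.{w} L.Structure)) : Prop :=
  ∀ (A B₀ B₁ : Bundled.{w} L.Structure) (f₀ : A ↪[L] B₀) (f₁ : A ↪[L] B₁),
    A ∈ K → B₀ ∈ K → B₁ ∈ K →
      ∃ (C : Bundled.{w} L.Structure) (g₀ : B₀ ↪[L] C) (g₁ : B₁ ↪[L] C),
        C ∈ K ∧ g₀.comp f₀ = g₁.comp f₁ ∧
          Set.range g₀ ∩ Set.range g₁ = Set.range (g₀.comp f₀)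

/-- The relational language with an `n`-ary relation symbol, `n ≥ 1`, for each quantifier-free type
of an `n`-tuple of elements of `M`. -/
def canLanguage : FirstOrder.Language.{0, max u v} where
  Functions _ := Empty
  Relations n := {p : Set (L.Formula (Fin n)) // 0 < n ∧ ∃ a : Fin n → M, qfType L a = p}

instance canLanguage_isRelational : (canLanguage L M).IsRelational :=
  fun _ => inferInstanceAs (IsEmpty Empty)

/-- The canonical structure of `M`, with the same domain: the symbol of a quantifier-free type `p`
holds exactly of the tuples with quantifier-free type `p`. -/
instance canStructure : (canLanguage L M).Structure M where
  funMap f _ := Empty.elim f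
  RelMap p a := qfType L a = p.1

end General

/-- The only function symbol is a binary one. -/
inductive MeetFunctions : ℕ → Type
  | meet : MeetFunctions 2

/-- The only relation symbol is a binary one. -/
inductive MeetRelations : ℕ → Type
  | lt : MeetRelations 2

/-- The language of meet-semilattices, with a binary relation symbol for `<` and a binary
function symbol for the meet. -/
def meetLanguage : FirstOrder.Language.{0, 0} where
  Functions := MeetFunctions
  Relations := MeetRelations

instance countable_meetFunctions : Countable (Σ n, meetLanguage.Functions n) := by
  have : Subsingleton (Σ n, meetLanguage.Functions n) :=
    ⟨by rintro ⟨_, ⟨⟩⟩ ⟨_, ⟨⟩⟩; rfl⟩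
  infer_instance

/-- The symbols are interpreted by the strict order and the meet of a meet-semilattice. -/
def IsMeetSemilattice (A : Type w) [meetLanguage.Structure A] : Prop :=
  ∃ _ : SemilatticeInf A, ∀ x y : A,
    (FirstOrder.Language.Structure.RelMap (L := meetLanguage) MeetRelations.lt ![x, y] ↔ x < y) ∧
    FirstOrder.Language.Structure.funMap (L := meetLanguage) MeetFunctions.meet ![x, y] = x ⊓ y

/-- The class of finite meet-semilattices (the empty one included). -/
def finiteMeetSemilattices : Set (Bundled.{w} meetLanguage.Structure) :=
  {A | Finite A ∧ IsMeetSemilattice A}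

/-- `S` is the generic meet-semilattice: the (countable) Fraïssé limit of the class of finite
meet-semilattices. -/
def IsGenericMeetSemilattice (S : Type w) [meetLanguage.Structure S] [Countable S] : Prop :=
  FirstOrder.Language.IsFraisseLimit (L := meetLanguage) finiteMeetSemilattices.{w} S

end Sunflower

namespace Sunflower

section Greedy

variable {T S : Type*} [SemilatticeInf T]

section

variable [SemilatticeInf S]

/-- `e` is injective and preserves meets on `D`. -/
def InfEmbOn (D : Set T) (e : T → S) : Prop :=
  Set.InjOn e D ∧ ∀ x ∈ D, ∀ y ∈ D, e (x ⊓ y) = e x ⊓ e y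

theorem InfEmbOn.le_iff {D : Set T} {e : T → S} (h : InfEmbOn D e) (hD : InfClosed D) {x y : T}
    (hx : x ∈ D) (hy : y ∈ D) : e x ≤ e y ↔ x ≤ y := by
  rw [← inf_eq_left, ← h.2 x hx y hy, ← inf_eq_left]
  exact ⟨fun H => h.1 (hD hx hy) hx H, fun H => by rw [H]⟩

theorem InfEmbOn.comp {R : Type*} [SemilatticeInf R] {φ : S → R} {e : T → S} {D : Set T}
    (hφ : InfEmbOn Set.univ φ) (h : InfEmbOn D e) : InfEmbOn D (φ ∘ e) :=
  ⟨fun x hx y hy hxy => h.1 hx hy (hφ.1 trivial trivial hxy), fun x hx y hy => by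
    simp only [Function.comp_apply, h.2 x hx y hy, hφ.2 _ trivial _ trivial]⟩

/-- `x` realises over `e '' D` the type of `w` over `D`. -/
def Realizes (D : Set T) (e : T → S) (w : T) (x : S) : Prop :=
  ∀ a ∈ D, x ≠ e a ∧ (w ≤ a → x ≤ e a) ∧ (¬ w ≤ a → x ⊓ e a = e (w ⊓ a))

open Classical in
theorem InfEmbOn.insert_update {D : Set T} {e : T → S} {w : T} {x : S} (h : InfEmbOn D e)
    (hD : InfClosed D) (hw : w ∉ D) (hD' : InfClosed (insert w D)) (hx : Realizes D e w x) :
    InfEmbOn (insert w D) (Function.update e w x) := by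
  have upd : ∀ a ∈ D, Function.update e w x a = e a := fun a ha =>
    Function.update_of_ne (ne_of_mem_of_not_mem ha hw) _ _
  have key : ∀ a ∈ D, Function.update e w x (w ⊓ a) = x ⊓ e a := by
    intro a ha
    by_cases hwa : w ≤ a
    · rw [inf_eq_left.2 hwa, Function.update_self, inf_eq_left.2 ((hx a ha).2.1 hwa)]
    · have : w ⊓ a ∈ D := by
        rcases hD' (Set.mem_insert w D) (Set.mem_insert_of_mem w ha) with h | h
        · exact absurd (inf_eq_left.1 h) hwa
        · exact h
      rw [upd _ this, (hx a ha).2.2 hwa]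
  refine ⟨?_, ?_⟩
  · rintro a (rfl | ha) b (rfl | hb) hab
    · rfl
    · rw [Function.update_self, upd b hb] at hab
      exact absurd hab (hx b hb).1
    · rw [Function.update_self, upd a ha] at hab
      exact absurd hab.symm (hx a ha).1
    · rw [upd a ha, upd b hb] at hab
      exact h.1 ha hb hab
  · rintro a (rfl | ha) b (rfl | hb)
    · simp
    · rw [key b hb, Function.update_self, upd b hb]
    · rw [inf_comm, key a ha, Function.update_self, upd a ha, inf_comm]
    · rw [upd a ha, upd b hb, upd _ (hD ha hb), h.2 a ha b hb]

theorem InfEmbOn.realizes {D : Set T} {e : T → S} {w : T} (h : InfEmbOn (insert w D) e)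
    (hw : w ∉ D) (hD' : InfClosed (insert w D)) : Realizes D e w (e w) := by
  intro a ha
  have hwm := Set.mem_insert w D
  have ham := Set.mem_insert_of_mem w ha
  refine ⟨fun H => hw (h.1 hwm ham H ▸ ha), (h.le_iff hD' hwm ham).2, fun _ => ?_⟩
  rw [h.2 w hwm a ham]

end

/-- One-point extensions suffice to go from one finite meet-closed set to a larger one. -/
theorem exists_extend_of_step (Q : Set T → (T → S) → Prop)
    (step : ∀ (D : Set T) (e : T → S) (w : T), D.Finite → InfClosed D → w ∉ D →
      InfClosed (insert w D) → Q D e → ∃ e', Q (insert w D) e' ∧ Set.EqOn e' e D)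
    {D D' : Set T} (hD' : D'.Finite) (cD : InfClosed D) (cD' : InfClosed D') (hDD' : D ⊆ D')
    {e : T → S} (he : Q D e) : ∃ e', Q D' e' ∧ Set.EqOn e' e D := by
  induction hn : (D' \ D).ncard generalizing D e with
  | zero =>
    have : D' \ D = ∅ := (Set.ncard_eq_zero hD'.sdiff).1 hn
    have : D = D' := hDD'.antisymm (Set.sdiff_eq_empty.1 this)
    exact ⟨e, this ▸ he, fun _ _ => rfl⟩
  | succ n ih =>
    have hne : (D' \ D).Nonempty := by
      rw [← Set.ncard_pos hD'.sdiff]; omega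
    obtain ⟨w, hw⟩ := hD'.sdiff.exists_minimal hne
    have cw : InfClosed (insert w D) := by
      have aux : ∀ a ∈ D, w ⊓ a ∈ insert w D := by
        intro a ha
        by_cases hm : w ⊓ a ∈ D
        · exact Or.inr hm
        · have := hw.2 ⟨cD' hw.1.1 (hDD' ha), hm⟩ inf_le_left
          exact Or.inl (le_antisymm inf_le_left this)
      rintro a (rfl | ha) b (rfl | hb)
      · simp
      · exact aux b hb
      · rw [inf_comm]; exact aux a ha
      · exact Or.inr (cD ha hb)
    obtain ⟨e', he', heq⟩ := step D e w (hD'.subset hDD') cD hw.1.2 cw he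
    obtain ⟨e'', he'', heq'⟩ := ih (D := insert w D) (e := e') cw
      (Set.insert_subset hw.1.1 hDD') he' (by
        have : D' \ insert w D = (D' \ D) \ {w} := by
          ext y; simp only [Set.mem_sdiff, Set.mem_insert_iff, Set.mem_singleton_iff]; tauto
        rw [this, Set.ncard_sdiff_singleton_of_mem hw.1, hn]; rfl)
    exact ⟨e'', he'', fun y hy => (heq' (Or.inr hy)).trans (heq hy)⟩

/-- One-point extensions suffice to build a map on a countable semilattice. -/
theorem exists_limit_of_step [Countable T] (Q : Set T → (T → S) → Prop)
    (step : ∀ (D : Set T) (e : T → S) (w : T), D.Finite → InfClosed D → w ∉ D →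
      InfClosed (insert w D) → Q D e → ∃ e', Q (insert w D) e' ∧ Set.EqOn e' e D)
    {e₀ : T → S} (h₀ : Q ∅ e₀) :
    ∃ φ : T → S, ∀ F : Set T, F.Finite →
      ∃ (D : Set T) (e : T → S), F ⊆ D ∧ InfClosed D ∧ Q D e ∧ Set.EqOn φ e D := by
  rcases isEmpty_or_nonempty T with hT | hT
  · exact ⟨e₀, fun F _ => ⟨∅, e₀, fun x => (hT.false x).elim, infClosed_empty, h₀,
      fun _ _ => rfl⟩⟩
  obtain ⟨s, hs⟩ := exists_surjective_nat T
  let D : ℕ → Set T := fun n => infClosure (s '' Set.Iio n)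
  have Dfin : ∀ n, (D n).Finite := fun n => ((Set.finite_Iio n).image s).infClosure
  have Dcl : ∀ n, InfClosed (D n) := fun n => infClosed_infClosure
  have Dmono : Monotone D := fun m n hmn =>
    infClosure_mono (Set.image_mono (Set.Iio_subset_Iio hmn))
  have D0 : D 0 = ∅ := by simp [D]
  have next : ∀ n (e : {e : T → S // Q (D n) e}),
      ∃ e' : {e : T → S // Q (D (n + 1)) e}, Set.EqOn e'.1 e.1 (D n) := by
    rintro n ⟨e, he⟩
    obtain ⟨e', h, h'⟩ := exists_extend_of_step Q step (Dfin (n + 1)) (Dcl n) (Dcl (n + 1))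
      (Dmono n.le_succ) he
    exact ⟨⟨e', h⟩, h'⟩
  choose nx hnx using next
  let E : ∀ n, {e : T → S // Q (D n) e} := fun n =>
    Nat.rec ⟨e₀, D0 ▸ h₀⟩ (fun n e => nx n e) n
  have hE : ∀ n, Set.EqOn (E (n + 1)).1 (E n).1 (D n) := fun n => hnx n (E n)
  have hE' : ∀ m n, m ≤ n → Set.EqOn (E n).1 (E m).1 (D m) := by
    intro m n hmn
    induction n, hmn using Nat.le_induction with
    | base => exact fun _ _ => rfl
    | succ n hmn ih => exact fun x hx => (hE n (Dmono hmn hx)).trans (ih hx)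
  have mem : ∀ x, ∃ n, x ∈ D n := fun x => by
    obtain ⟨i, rfl⟩ := hs x
    exact ⟨i + 1, subset_infClosure ⟨i, Nat.lt_succ_self i, rfl⟩⟩
  choose N hN using mem
  refine ⟨fun x => (E (N x)).1 x, fun F hF => ?_⟩
  obtain ⟨n, hn⟩ := (hF.image N).bddAbove
  refine ⟨D n, (E n).1, fun x hx => Dmono (hn ⟨x, hx, rfl⟩) (hN x), Dcl n, (E n).2, ?_⟩
  intro x hx
  rcases le_total (N x) n with h | h
  · exact (hE' _ _ h (hN x)).symm
  · exact hE' _ _ h hx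

end Greedy

/-- Meet-embeddings of a finite meet-semilattice into `S` extend to larger finite
meet-semilattices. -/
def FiniteExtension (S : Type) [SemilatticeInf S] : Prop :=
  ∀ (T : Type) [SemilatticeInf T] (A D : Set T) (e : T → S), D.Finite → InfClosed A →
    InfClosed D → A ⊆ D → InfEmbOn A e → ∃ e' : T → S, InfEmbOn D e' ∧ Set.EqOn e' e A

/-- The same with one-point extensions of finite meet-semilattices. -/
def OnePointExtension (S : Type) [SemilatticeInf S] : Prop :=
  ∀ (T : Type) [SemilatticeInf T] [Finite T] (A : Set T) (e : T → S) (w : T), InfClosed A →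
    InfClosed (insert w A) → w ∉ A → InfEmbOn A e → ∃ x : S, Realizes A e w x

section

variable {S : Type} [SemilatticeInf S]

theorem OnePointExtension.finiteExtension (h : OnePointExtension S) : FiniteExtension S := by
  classical
  intro T _ A D e hD cA cD hAD he
  refine exists_extend_of_step InfEmbOn ?_ hD cA cD hAD he
  intro B f w hB cB hw cBw hf
  let T' : Type := infClosure (insert w B)
  let _ : SemilatticeInf T' := Subtype.semilatticeInf fun {x y} hx hy => infClosed_infClosure hx hy
  have : Finite T' := (hB.insert w).infClosure
  let w' : T' := ⟨w, subset_infClosure (Set.mem_insert w B)⟩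
  have hwB : insert w' ((↑) ⁻¹' B) = ((↑) : T' → T) ⁻¹' insert w B := by
    ext y; exact or_congr_left Subtype.ext_iff
  obtain ⟨x, hx⟩ := h T' (((↑) : T' → T) ⁻¹' B) (fun y => f y) w' (fun a ha b hb => cB ha hb)
    (by rw [hwB]; exact fun a ha b hb => cBw ha hb) (fun h => hw h)
    ⟨fun a ha b hb hab => Subtype.ext (hf.1 ha hb hab), fun a ha b hb => hf.2 _ ha _ hb⟩
  refine ⟨Function.update f w x, hf.insert_update cB hw cBw ?_, fun y hy =>
    Function.update_of_ne (ne_of_mem_of_not_mem hy hw) _ _⟩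
  intro a ha
  exact hx ⟨a, subset_infClosure (Set.mem_insert_of_mem w ha)⟩ ha

theorem FiniteExtension.exists_realizes (h : FiniteExtension S) {T : Type} [SemilatticeInf T]
    {D : Set T} {e : T → S} {w : T} (hD : D.Finite) (cD : InfClosed D) (hw : w ∉ D)
    (cw : InfClosed (insert w D)) (he : InfEmbOn D e) : ∃ x, Realizes D e w x := by
  obtain ⟨e', he', heq⟩ := h T D (insert w D) e (hD.insert w) cD cw (Set.subset_insert _ _) he
  refine ⟨e' w, fun a ha => ?_⟩
  obtain ⟨h1, h2, h3⟩ := he'.realizes hw cw a ha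
  rw [heq ha] at h1 h2 h3
  refine ⟨h1, h2, fun hwa => ?_⟩
  rw [h3 hwa]
  refine heq ?_
  rcases cw (Set.mem_insert w D) (Set.mem_insert_of_mem w ha) with h | h
  · exact absurd (inf_eq_left.1 h) hwa
  · exact h

/-- A self-embedding of `S` is built by realising types one at a time, keeping a binary relation
between the values. -/
theorem exists_embedding_of_step [Countable S] (r : S → S → Prop)
    (step : ∀ (D : Set S) (e : S → S) (w : S), D.Finite → InfClosed D → w ∉ D →
      InfClosed (insert w D) → InfEmbOn D e → (∀ a ∈ D, ∀ b ∈ D, r (e a) (e b)) →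
      ∃ x, Realizes D e w x ∧ r x x ∧ ∀ a ∈ D, r (e a) x ∧ r x (e a)) :
    ∃ φ : S → S, InfEmbOn Set.univ φ ∧ ∀ a b, r (φ a) (φ b) := by
  classical
  obtain ⟨φ, hφ⟩ := exists_limit_of_step
    (fun (D : Set S) (e : S → S) => InfEmbOn D e ∧ ∀ a ∈ D, ∀ b ∈ D, r (e a) (e b))
    (by
      rintro D e w hD cD hw cw ⟨he, her⟩
      obtain ⟨x, hx, hxx, hxr⟩ := step D e w hD cD hw cw he her
      have upd : Set.EqOn (Function.update e w x) e D := fun y hy =>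
        Function.update_of_ne (ne_of_mem_of_not_mem hy hw) _ _
      refine ⟨Function.update e w x, ⟨he.insert_update cD hw cw hx, ?_⟩, upd⟩
      rintro a (rfl | ha) b (rfl | hb)
      · simpa using hxx
      · rw [Function.update_self, upd hb]; exact (hxr b hb).2
      · rw [Function.update_self, upd ha]; exact (hxr a ha).1
      · rw [upd ha, upd hb]; exact her a ha b hb)
    (e₀ := id) ⟨⟨fun _ h => h.elim, fun _ h => h.elim⟩, fun _ h => h.elim⟩
  have key : ∀ a b, (φ a = φ b → a = b) ∧ φ (a ⊓ b) = φ a ⊓ φ b ∧ r (φ a) (φ b) := by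
    intro a b
    obtain ⟨D, e, hF, cD, ⟨he, her⟩, heq⟩ := hφ {a, b} (by simp)
    have ha : a ∈ D := hF (by simp)
    have hb : b ∈ D := hF (by simp)
    rw [heq ha, heq hb, heq (cD ha hb)]
    exact ⟨fun h => he.1 ha hb h, he.2 a ha b hb, her a ha b hb⟩
  exact ⟨φ, ⟨fun a _ b _ h => (key a b).1 h, fun a _ b _ => (key a b).2.1⟩,
    fun a b => (key a b).2.2⟩

/-- Every open interval contains a copy of `S`. -/
theorem FiniteExtension.exists_embedding_Ioo [Countable S] (h : FiniteExtension S) {c b : S}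
    (hcb : c < b) : ∃ φ : S → S, InfEmbOn Set.univ φ ∧ ∀ x, c < φ x ∧ φ x < b := by
  obtain ⟨φ, hφ, hr⟩ := exists_embedding_of_step (fun x _ : S => c < x ∧ x < b) (by
    intro D e w hD cD hw cw he her
    let f : WithBot (WithTop S) → S := WithBot.recBotCoe c (WithTop.recTopCoe b e)
    let ι : S → WithBot (WithTop S) := fun x => ((x : WithTop S) : WithBot (WithTop S))
    let t : WithBot (WithTop S) := ((⊤ : WithTop S) : WithBot (WithTop S))
    have hιt : ∀ x, ι x < t := fun x => WithBot.coe_lt_coe.2 (WithTop.coe_lt_top x)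
    have hιb : ∀ x, (⊥ : WithBot (WithTop S)) < ι x := fun x => WithBot.bot_lt_coe _
    have hιi : ∀ x y, ι (x ⊓ y) = ι x ⊓ ι y := fun x y => rfl
    have hιinj : Function.Injective ι := fun x y h =>
      WithTop.coe_injective (WithBot.coe_injective h)
    have hιle : ∀ x y, ι x ≤ ι y ↔ x ≤ y := fun x y => by
      rw [← inf_eq_left, ← hιi, hιinj.eq_iff, inf_eq_left]
    have closed : ∀ B : Set S, InfClosed B → InfClosed (insert ⊥ (insert t (ι '' B))) := by
      rintro B cB a (rfl | rfl | ⟨a, ha, rfl⟩) a' (rfl | rfl | ⟨a', ha', rfl⟩)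
      · simp
      · simp
      · simp
      · simp
      · simp
      · rw [inf_eq_right.2 (hιt _).le]; exact Or.inr (Or.inr ⟨_, ha', rfl⟩)
      · simp
      · rw [inf_eq_left.2 (hιt _).le]; exact Or.inr (Or.inr ⟨_, ha, rfl⟩)
      · exact Or.inr (Or.inr ⟨_, cB ha ha', rfl⟩)
    have ft : f t = b := rfl
    have fb : f ⊥ = c := rfl
    have fι : ∀ x, f (ι x) = e x := fun x => rfl
    have hr : ∀ a ∈ D, c < e a ∧ e a < b := fun a ha => her a ha a ha
    have hf : InfEmbOn (insert ⊥ (insert t (ι '' D))) f := by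
      refine ⟨?_, ?_⟩
      · rintro a (rfl | rfl | ⟨a, ha, rfl⟩) a' (rfl | rfl | ⟨a', ha', rfl⟩) haa
        · rfl
        · exact absurd haa hcb.ne
        · exact absurd haa (hr _ ha').1.ne
        · exact absurd haa hcb.ne'
        · rfl
        · exact absurd haa (hr _ ha').2.ne'
        · exact absurd haa (hr _ ha).1.ne'
        · exact absurd haa (hr _ ha).2.ne
        · rw [he.1 ha ha' haa]
      · rintro a (rfl | rfl | ⟨a, ha, rfl⟩) a' (rfl | rfl | ⟨a', ha', rfl⟩)
        · simp
        · simp [fb, ft, hcb.le]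
        · simp [fb, fι, (hr _ ha').1.le]
        · simp [fb, ft, hcb.le]
        · simp
        · rw [inf_eq_right.2 (hιt _).le, ft, fι, inf_eq_right.2 (hr _ ha').2.le]
        · simp [fb, fι, (hr _ ha).1.le]
        · rw [inf_eq_left.2 (hιt _).le, ft, fι, inf_eq_left.2 (hr _ ha).2.le]
        · rw [← hιi, fι, fι, fι, he.2 a ha a' ha']
    have hιw : ι w ∉ (insert ⊥ (insert t (ι '' D)) : Set (WithBot (WithTop S))) := by
      rintro (h | h | ⟨a, ha, h⟩)
      · exact (hιb w).ne' h
      · exact (hιt w).ne h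
      · exact hw (hιinj h ▸ ha)
    have hins : (insert (ι w) (insert ⊥ (insert t (ι '' D))) : Set (WithBot (WithTop S))) =
        insert ⊥ (insert t (ι '' insert w D)) := by
      rw [Set.image_insert_eq, Set.insert_comm (ι w), Set.insert_comm (ι w)]
    obtain ⟨x, hx⟩ := h.exists_realizes (((hD.image ι).insert t).insert ⊥) (closed D cD) hιw
      (by rw [hins]; exact closed _ cw) hf
    have hxb : x < b := by
      obtain ⟨h1, h2, -⟩ := hx t (by simp)
      exact lt_of_le_of_ne (h2 (hιt w).le) h1
    have hxc : c < x := by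
      obtain ⟨h1, -, h3⟩ := hx ⊥ (by simp)
      have h3 := h3 (not_le_of_gt (hιb w))
      rw [inf_bot_eq, fb, inf_eq_right] at h3
      exact lt_of_le_of_ne h3 h1.symm
    refine ⟨x, fun a ha => ?_, ⟨hxc, hxb⟩, fun a ha => ⟨hr a ha, hxc, hxb⟩⟩
    obtain ⟨h1, h2, h3⟩ := hx (ι a) (Or.inr (Or.inr ⟨a, ha, rfl⟩))
    rw [hιle] at h2 h3
    exact ⟨h1, h2, fun hwa => by rw [← fι, h3 hwa, ← hιi, fι]⟩)
  exact ⟨φ, hφ, fun x => hr x x⟩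

theorem Realizes.of_mem_Icc {D : Set S} {e : S → S} {w c b x : S} (hc : Realizes D e w c)
    (hb : Realizes D e w b) (hcx : c ≤ x) (hxb : x ≤ b) : Realizes D e w x := by
  intro a ha
  obtain ⟨hc1, -, hc3⟩ := hc a ha
  obtain ⟨hb1, hb2, hb3⟩ := hb a ha
  refine ⟨?_, fun hwa => hxb.trans (hb2 hwa), fun hwa => ?_⟩
  · rintro rfl
    by_cases hwa : w ≤ a
    · exact hb1 (le_antisymm (hb2 hwa) hxb)
    · have := hc3 hwa
      rw [← hb3 hwa, inf_eq_left.2 hcx, inf_eq_right.2 hxb] at this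
      exact hc1 this
  · refine le_antisymm ?_ ?_
    · rw [← hb3 hwa]; exact inf_le_inf_right _ hxb
    · rw [← hc3 hwa]; exact inf_le_inf_right _ hcx

/-- The set of realisations of a one-point extension contains a copy of `S`. -/
theorem FiniteExtension.exists_embedding_realizes [Countable S] (h : FiniteExtension S)
    {D : Set S} {e : S → S} {w : S} (hD : D.Finite) (cD : InfClosed D) (hw : w ∉ D)
    (cw : InfClosed (insert w D)) (he : InfEmbOn D e) :
    ∃ φ : S → S, InfEmbOn Set.univ φ ∧ ∀ x, Realizes D e w (φ x) := by
  classical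
  let ι : S → S × Bool := fun x => (x, decide (w ≤ x))
  have hιi : ∀ x y, ι (x ⊓ y) = ι x ⊓ ι y := fun x y => by
    ext <;> simp [ι]
  have hιinj : Function.Injective ι := fun x y h => congrArg Prod.fst h
  obtain ⟨f, hf, hfe⟩ := h (S × Bool) (ι '' D) (insert w D ×ˢ Set.univ) (fun p => e p.1)
    ((hD.insert w).prod Set.finite_univ)
    (by rintro _ ⟨a, ha, rfl⟩ _ ⟨b, hb, rfl⟩; exact ⟨_, cD ha hb, hιi a b⟩)
    (fun a ha b hb => ⟨cw ha.1 hb.1, trivial⟩)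
    (by rintro _ ⟨a, ha, rfl⟩; exact ⟨Or.inr ha, trivial⟩)
    ⟨by rintro _ ⟨a, ha, rfl⟩ _ ⟨b, hb, rfl⟩ hab; rw [he.1 ha hb hab],
      by rintro _ ⟨a, ha, rfl⟩ _ ⟨b, hb, rfl⟩; exact he.2 a ha b hb⟩
  have cl : InfClosed (insert w D ×ˢ (Set.univ : Set Bool)) :=
    fun a ha b hb => ⟨cw ha.1 hb.1, trivial⟩
  have mw : ∀ t : Bool, (w, t) ∈ insert w D ×ˢ (Set.univ : Set Bool) := fun t => by simp
  have mD : ∀ a ∈ D, ∀ t : Bool, (a, t) ∈ insert w D ×ˢ (Set.univ : Set Bool) :=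
    fun a ha t => by simp [ha]
  have fD : ∀ a ∈ D, f (a, decide (w ≤ a)) = e a := fun a ha => hfe ⟨a, ha, rfl⟩
  have key : ∀ t : Bool, Realizes D e w (f (w, t)) := by
    intro t a ha
    rw [← fD a ha]
    refine ⟨fun H => ?_, fun hwa => ?_, fun hwa => ?_⟩
    · have := congrArg Prod.fst (hf.1 (mw t) (mD a ha _) H)
      exact ne_of_mem_of_not_mem ha hw this.symm
    · rw [hf.le_iff cl (mw t) (mD a ha _)]
      refine ⟨hwa, ?_⟩
      simp [hwa, Bool.le_true]
    · have hm : w ⊓ a ∈ D := by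
        rcases cw (Set.mem_insert w D) (Set.mem_insert_of_mem w ha) with h | h
        · exact absurd (inf_eq_left.1 h) hwa
        · exact h
      rw [← hf.2 _ (mw t) _ (mD a ha _), ← fD _ hm]
      congr 1
      ext <;> simp [hwa]
  have hlt : f (w, false) < f (w, true) := by
    refine lt_of_le_of_ne ?_ ?_
    · rw [hf.le_iff cl (mw _) (mw _)]; exact ⟨le_rfl, by simp⟩
    · intro H
      simpa using hf.1 (mw _) (mw _) H
  obtain ⟨φ, hφ, hx⟩ := h.exists_embedding_Ioo hlt
  exact ⟨φ, hφ, fun x =>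
    Realizes.of_mem_Icc (key false) (key true) (hx x).1.le (hx x).2.le⟩

theorem FiniteExtension.exists_embedding_mem_or_notMem [Countable S] (h : FiniteExtension S)
    (C : Set S) : ∃ φ : S → S, InfEmbOn Set.univ φ ∧ ((∀ x, φ x ∈ C) ∨ ∀ x, φ x ∉ C) := by
  by_cases H : ∀ (D : Set S) (e : S → S) (w : S), D.Finite → InfClosed D → w ∉ D →
      InfClosed (insert w D) → InfEmbOn D e → ∃ x, Realizes D e w x ∧ x ∈ C
  · obtain ⟨φ, hφ, hr⟩ := exists_embedding_of_step (fun x y : S => x ∈ C ∧ y ∈ C) (by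
      intro D e w hD cD hw cw he her
      obtain ⟨x, hx, hxC⟩ := H D e w hD cD hw cw he
      exact ⟨x, hx, ⟨hxC, hxC⟩, fun a ha => ⟨⟨(her a ha a ha).1, hxC⟩, hxC, (her a ha a ha).1⟩⟩)
    exact ⟨φ, hφ, Or.inl fun x => (hr x x).1⟩
  · push Not at H
    obtain ⟨D, e, w, hD, cD, hw, cw, he, hx⟩ := H
    obtain ⟨φ, hφ, hr⟩ := h.exists_embedding_realizes hD cD hw cw he
    exact ⟨φ, hφ, Or.inr fun x => hx _ (hr x)⟩

theorem FiniteExtension.exists_embedding_const [Countable S] (h : FiniteExtension S)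
    {ι : Type*} (F : Finset ι) (χ : S → ι) (hχ : ∀ x, χ x ∈ F) (x₀ : S) :
    ∃ φ : S → S, InfEmbOn Set.univ φ ∧ ∃ i, ∀ x, χ (φ x) = i := by
  classical
  induction F using Finset.induction_on generalizing χ with
  | empty => exact absurd (hχ x₀) (Finset.notMem_empty _)
  | insert i F hi ih =>
    obtain ⟨φ, hφ, hC | hC⟩ := h.exists_embedding_mem_or_notMem {x | χ x = i}
    · exact ⟨φ, hφ, i, hC⟩
    · obtain ⟨ψ, hψ, j, hj⟩ := ih (χ ∘ φ) (fun x =>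
        (Finset.mem_insert.1 (hχ (φ x))).resolve_left (hC x))
      exact ⟨φ ∘ ψ, hφ.comp hψ, j, hj⟩

theorem FiniteExtension.exists_embedding_sunflower [Countable S] (h : FiniteExtension S)
    {X : Type*} (k : ℕ) (f : S → Finset X) (hf : ∀ x, (f x).card = k) :
    ∃ φ : S → S, InfEmbOn Set.univ φ ∧ ∃ c : Set X, ∀ a b, a ≠ b →
      ((f (φ a) : Finset X) : Set X) ∩ (f (φ b) : Finset X) = c := by
  classical
  induction k generalizing f with
  | zero =>
    refine ⟨id, ⟨Function.injective_id.injOn, fun _ _ _ _ => rfl⟩, ∅, fun a b _ => ?_⟩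
    simp [Finset.card_eq_zero.1 (hf a)]
  | succ k ih =>
    by_cases H : ∀ (D : Set S) (e : S → S) (w : S), D.Finite → InfClosed D → w ∉ D →
      InfClosed (insert w D) → InfEmbOn D e →
        ∃ x, Realizes D e w x ∧ ∀ a ∈ D, Disjoint (f x) (f (e a))
    · obtain ⟨φ, hφ, hr⟩ := exists_embedding_of_step
        (fun x y : S => x ≠ y → Disjoint (f x) (f y)) (by
        intro D e w hD cD hw cw he her
        obtain ⟨x, hx, hxd⟩ := H D e w hD cD hw cw he
        exact ⟨x, hx, fun h => absurd rfl h, fun a ha =>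
          ⟨fun _ => (hxd a ha).symm, fun _ => hxd a ha⟩⟩)
      refine ⟨φ, hφ, ∅, fun a b hab => ?_⟩
      have := hr a b (fun h => hab (hφ.1 trivial trivial h))
      rw [← Finset.coe_inter, Finset.disjoint_iff_inter_eq_empty.1 this, Finset.coe_empty]
    · push Not at H
      obtain ⟨D, e, w, hD, cD, hw, cw, he, hx⟩ := H
      obtain ⟨φ, hφ, hr⟩ := h.exists_embedding_realizes hD cD hw cw he
      have hp : ∀ x, ∃ p, p ∈ f (φ x) ∧ p ∈ hD.toFinset.biUnion (fun a => f (e a)) := by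
        intro x
        obtain ⟨a, ha, hd⟩ := hx _ (hr x)
        obtain ⟨p, hp, hp'⟩ := Finset.not_disjoint_iff.1 hd
        exact ⟨p, hp, Finset.mem_biUnion.2 ⟨a, hD.mem_toFinset.2 ha, hp'⟩⟩
      choose χ hχ hχ' using hp
      obtain ⟨ψ, hψ, p, hp⟩ := h.exists_embedding_const _ χ hχ' w
      have hpm : ∀ x, p ∈ f (φ (ψ x)) := fun x => hp x ▸ hχ (ψ x)
      obtain ⟨θ, hθ, c, hc⟩ := ih (fun x => (f (φ (ψ x))).erase p) (fun x => by
        rw [Finset.card_erase_of_mem (hpm x), hf]; rfl)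
      refine ⟨φ ∘ ψ ∘ θ, hφ.comp (hψ.comp hθ), insert p c, fun a b hab => ?_⟩
      rw [← hc a b hab]
      ext y
      have h1 := hpm (θ a)
      have h2 := hpm (θ b)
      by_cases hy : y = p
      · subst hy; simp [h1, h2]
      · simp [hy]

theorem FiniteExtension.noMaxOrder (h : FiniteExtension S) : NoMaxOrder S := by
  refine ⟨fun x => ?_⟩
  obtain ⟨e, he, heq⟩ := h ℕ {0} (Set.Iic 1) (fun _ => x) (Set.finite_Iic 1) infClosed_singleton
    (fun a ha b _ => Set.mem_Iic.2 (inf_le_left.trans (Set.mem_Iic.1 ha))) (by simp)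
    ⟨by simp, fun _ _ _ _ => by simp⟩
  have h0 : e 0 = x := heq rfl
  refine ⟨e 1, lt_of_le_of_ne ?_ ?_⟩
  · rw [← h0, he.le_iff (fun a ha b _ => Set.mem_Iic.2 (inf_le_left.trans (Set.mem_Iic.1 ha))) (by simp) (by simp)]
    exact zero_le_one
  · rw [← h0]
    exact fun H => zero_ne_one (he.1 (by simp) (by simp) H)

theorem FiniteExtension.infinite [Nonempty S] (h : FiniteExtension S) : Infinite S :=
  have := h.noMaxOrder
  NoMaxOrder.infinite

theorem FiniteExtension.exists_inf_ne [Nonempty S] (h : FiniteExtension S) :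
    ∃ a b : S, a ⊓ b ≠ a ∧ a ⊓ b ≠ b := by
  obtain ⟨e, he, -⟩ := h (Bool × Bool) ∅ Set.univ (fun _ => Classical.arbitrary S)
    Set.finite_univ infClosed_empty infClosed_univ (Set.empty_subset _)
    ⟨fun _ h => h.elim, fun _ h => h.elim⟩
  refine ⟨e (true, false), e (false, true), ?_, ?_⟩ <;>
  · rw [← he.2 _ trivial _ trivial]
    intro H
    simpa using he.1 trivial trivial H

end

open FirstOrder.Language FirstOrder.Language.Structure

/-- The structure of a meet-semilattice in the language `{<, ∧}` is the intended one. -/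
def IsCompatible (A : Type*) [meetLanguage.Structure A] [SemilatticeInf A] : Prop :=
  ∀ x y : A, (RelMap (L := meetLanguage) MeetRelations.lt ![x, y] ↔ x < y) ∧
    funMap (L := meetLanguage) MeetFunctions.meet ![x, y] = x ⊓ y

/-- The intended structure of a meet-semilattice. -/
@[reducible]
def meetStructure (A : Type*) [SemilatticeInf A] : meetLanguage.Structure A where
  funMap {_} f v := match f with
    | .meet => v 0 ⊓ v 1
  RelMap {_} r v := match r with
    | .lt => v 0 < v 1

theorem isCompatible_meetStructure (A : Type*) [SemilatticeInf A] :
    @IsCompatible A (meetStructure A) _ :=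
  fun _ _ => ⟨Iff.rfl, rfl⟩

/-- The meet symbol. -/
def meetSymbol : meetLanguage.Functions 2 := MeetFunctions.meet

/-- The order symbol. -/
def ltSymbol : meetLanguage.Relations 2 := MeetRelations.lt

/-- The interpretation of the meet symbol. -/
def meetOp {A : Type*} [meetLanguage.Structure A] (x y : A) : A :=
  funMap meetSymbol ![x, y]

/-- The interpretation of the order symbol. -/
def ltRel {A : Type*} [meetLanguage.Structure A] (x y : A) : Prop :=
  RelMap ltSymbol ![x, y]

theorem map_meetOp {A B : Type*} [meetLanguage.Structure A] [meetLanguage.Structure B]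
    (g : A ↪[meetLanguage] B) (x y : A) : g (meetOp x y) = meetOp (g x) (g y) := by
  rw [meetOp, g.map_fun, meetOp]
  congr 1
  ext i; fin_cases i <;> rfl

theorem map_ltRel {A B : Type*} [meetLanguage.Structure A] [meetLanguage.Structure B]
    (g : A ↪[meetLanguage] B) (x y : A) : ltRel (g x) (g y) ↔ ltRel x y := by
  rw [ltRel, ltRel, ← g.map_rel]
  refine iff_of_eq (congrArg _ ?_)
  ext i; fin_cases i <;> rfl

/-- An equational description of meet-semilattices. -/
theorem isMeetSemilattice_iff {A : Type*} [meetLanguage.Structure A] :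
    IsMeetSemilattice A ↔ ∀ x y z : A, meetOp x x = x ∧ meetOp x y = meetOp y x ∧
      meetOp (meetOp x y) z = meetOp x (meetOp y z) ∧ (ltRel x y ↔ meetOp x y = x ∧ x ≠ y) := by
  constructor
  · rintro ⟨_, h⟩ x y z
    have hm : ∀ x y : A, meetOp x y = x ⊓ y := fun x y => (h x y).2
    have hl : ltRel x y ↔ x < y := (h x y).1
    simp only [hm, hl]
    refine ⟨inf_idem x, inf_comm x y, inf_assoc x y z, ?_⟩
    rw [inf_eq_left, lt_iff_le_and_ne]
  · intro h
    let _ : Min A := ⟨meetOp⟩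
    let I : SemilatticeInf A := SemilatticeInf.mk' (fun x y => (h x y x).2.1)
      (fun x y z => (h x y z).2.2.1) (fun x => (h x x x).1)
    refine ⟨I, fun x y => ⟨(h x y x).2.2.2.trans ?_, rfl⟩⟩
    rw [lt_iff_le_and_ne, ← inf_eq_left]
    rfl

theorem IsMeetSemilattice.of_embedding {A B : Type*} [meetLanguage.Structure A]
    [meetLanguage.Structure B] (hB : IsMeetSemilattice B) (g : A ↪[meetLanguage] B) :
    IsMeetSemilattice A := by
  rw [isMeetSemilattice_iff] at hB ⊢
  intro x y z
  obtain ⟨h1, h2, h3, h4⟩ := hB (g x) (g y) (g z)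
  simp only [← map_meetOp, map_ltRel, g.injective.eq_iff, g.injective.ne_iff] at h1 h2 h3 h4
  exact ⟨h1, h2, h3, h4⟩

/-- A structure is a meet-semilattice if any three elements lie in an embedded one. -/
theorem isMeetSemilattice_of_local {A : Type*} [meetLanguage.Structure A]
    (h : ∀ v : Fin 3 → A, ∃ (B : Type) (_ : meetLanguage.Structure B) (g : B ↪[meetLanguage] A),
      IsMeetSemilattice B ∧ ∀ i, v i ∈ Set.range g) : IsMeetSemilattice A := by
  rw [isMeetSemilattice_iff]
  intro x y z
  obtain ⟨B, _, g, hB, hv⟩ := h ![x, y, z]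
  obtain ⟨x, rfl⟩ := hv 0
  obtain ⟨y, rfl⟩ := hv 1
  obtain ⟨z, rfl⟩ := hv 2
  obtain ⟨h1, h2, h3, h4⟩ := isMeetSemilattice_iff.1 hB x y z
  simp only [← map_meetOp, map_ltRel, g.injective.eq_iff, g.injective.ne_iff, h4]
  exact ⟨h1, h2, h3, trivial⟩

section Compatible

variable {A B : Type*} [meetLanguage.Structure A] [meetLanguage.Structure B] [SemilatticeInf A]
  [SemilatticeInf B]

theorem IsCompatible.map_inf (hA : IsCompatible A) (hB : IsCompatible B)
    (g : A ↪[meetLanguage] B) (x y : A) : g (x ⊓ y) = g x ⊓ g y := by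
  rw [← (hA x y).2, ← (hB _ _).2]
  exact map_meetOp g x y

theorem IsCompatible.infEmbOn (hA : IsCompatible A) (hB : IsCompatible B)
    (g : A ↪[meetLanguage] B) : InfEmbOn Set.univ g :=
  ⟨g.injective.injOn, fun x _ y _ => hA.map_inf hB g x y⟩

/-- A meet-embedding as an embedding of structures. -/
def IsCompatible.toEmbedding (hA : IsCompatible A) (hB : IsCompatible B) (φ : A → B)
    (hφ : InfEmbOn Set.univ φ) : A ↪[meetLanguage] B where
  toFun := φ
  inj' := fun _ _ h => hφ.1 trivial trivial h
  map_fun' := by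
    rintro _ ⟨⟩ v
    have h1 : v = ![v 0, v 1] := by ext i; fin_cases i <;> rfl
    have h2 : φ ∘ v = ![φ (v 0), φ (v 1)] := by ext i; fin_cases i <;> rfl
    rw [h2]
    refine Eq.trans ?_ (hB _ _).2.symm
    rw [← hφ.2 _ trivial _ trivial, ← (hA _ _).2, ← h1]
  map_rel' := by
    rintro _ ⟨⟩ v
    have h1 : v = ![v 0, v 1] := by ext i; fin_cases i <;> rfl
    have h2 : φ ∘ v = ![φ (v 0), φ (v 1)] := by ext i; fin_cases i <;> rfl
    rw [h2]
    refine (hB _ _).1.trans (Iff.trans ?_ (iff_of_eq (congrArg _ h1.symm)))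
    refine Iff.trans ?_ (hA _ _).1.symm
    rw [lt_iff_le_not_ge, lt_iff_le_not_ge, hφ.le_iff infClosed_univ trivial trivial,
      hφ.le_iff infClosed_univ trivial trivial]

theorem IsCompatible.infClosed (hA : IsCompatible A) (N : meetLanguage.Substructure A) :
    InfClosed (N : Set A) := by
  intro x hx y hy
  rw [← (hA x y).2]
  exact N.fun_mem _ _ (fun i => by fin_cases i <;> assumption)

theorem IsCompatible.finite_of_fg (hA : IsCompatible A) {N : meetLanguage.Substructure A}
    (hN : N.FG) : (N : Set A).Finite := by
  obtain ⟨s, hs, rfl⟩ := Substructure.fg_def.1 hN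
  let P : meetLanguage.Substructure A :=
    { carrier := infClosure s
      fun_mem := by
        rintro _ ⟨⟩ v hv
        have h1 : v = ![v 0, v 1] := by ext i; fin_cases i <;> rfl
        rw [h1]
        have := (hA (v 0) (v 1)).2
        have h2 : v 0 ⊓ v 1 ∈ infClosure s := infClosed_infClosure (hv 0) (hv 1)
        rw [← this] at h2
        exact h2 }
  exact hs.infClosure.subset (Substructure.closure_le (S := P).2 subset_infClosure)

end Compatible

theorem exists_isCompatible {A : Type*} [meetLanguage.Structure A] (h : IsMeetSemilattice A) :
    ∃ _ : SemilatticeInf A, IsCompatible A := h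

/-- What the proofs use of the generic meet-semilattice. -/
theorem IsGenericMeetSemilattice.exists_finiteExtension {S : Type} [meetLanguage.Structure S]
    [Countable S] (hS : IsGenericMeetSemilattice S) :
    ∃ _ : SemilatticeInf S, IsCompatible S ∧ Nonempty S ∧ FiniteExtension S := by
  have hage : ∀ N : Bundled.{0} meetLanguage.Structure,
      N ∈ meetLanguage.age S ↔ Finite N ∧ IsMeetSemilattice N := fun N => by rw [hS.age]; rfl
  have hsl : IsMeetSemilattice S := isMeetSemilattice_of_local fun v => by
    let N := Substructure.closure meetLanguage (Set.range v)
    have hN : N.FG := Substructure.fg_closure (Set.finite_range v)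
    exact ⟨N, inferInstance, N.subtype, ((hage _).1 (age.fg_substructure hN)).2,
      fun i => ⟨⟨v i, Substructure.subset_closure ⟨i, rfl⟩⟩, rfl⟩⟩
  obtain ⟨I, hI⟩ := exists_isCompatible hsl
  have emb : ∀ (T : Type) [SemilatticeInf T] [Finite T] [meetLanguage.Structure T],
      IsCompatible T → Nonempty (T ↪[meetLanguage] S) := fun T _ _ _ hT =>
    ((hage (Bundled.of T)).2 ⟨‹_›, (⟨_, hT⟩ : IsMeetSemilattice T)⟩).2
  refine ⟨I, hI, ?_, ?_⟩
  · let _ := meetStructure Unit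
    exact ⟨(emb Unit (isCompatible_meetStructure Unit)).some ()⟩
  · classical
    intro T _ A D e hD cA cD hAD he
    let _ : SemilatticeInf A := Subtype.semilatticeInf fun {x y} hx hy => cA hx hy
    let _ : SemilatticeInf D := Subtype.semilatticeInf fun {x y} hx hy => cD hx hy
    let _ := meetStructure A
    let _ := meetStructure D
    have hcA := isCompatible_meetStructure A
    have hcD := isCompatible_meetStructure D
    have : Finite A := hD.subset hAD
    have : Finite D := hD
    have := emb D hcD
    obtain ⟨f, hf⟩ := hS.ultrahomogeneous.extend_embedding (S := A) (T := D) FG.of_finite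
      (hcA.toEmbedding hI (fun x => e x)
        ⟨fun a _ b _ h => Subtype.ext (he.1 a.2 b.2 h), fun a _ b _ => he.2 _ a.2 _ b.2⟩)
      (hcA.toEmbedding hcD (Set.inclusion hAD)
        ⟨(Set.inclusion_injective hAD).injOn, fun a _ b _ => rfl⟩)
    have hf' : ∀ a : A, e a = f (Set.inclusion hAD a) := fun a => DFunLike.congr_fun hf a
    refine ⟨fun t => if h : t ∈ D then f ⟨t, h⟩ else e t, ⟨?_, ?_⟩, ?_⟩
    · intro a ha b hb hab
      simp only [ha, hb, dif_pos] at hab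
      exact congrArg Subtype.val (f.injective hab)
    · intro a ha b hb
      simp only [ha, hb, cD ha hb, dif_pos]
      exact hcD.map_inf hI f ⟨a, ha⟩ ⟨b, hb⟩
    · intro a ha
      simp only [hAD ha, dif_pos]
      exact (hf' ⟨a, ha⟩).symm

theorem FiniteExtension.isGenericMeetSemilattice {S : Type} [meetLanguage.Structure S]
    [Countable S] [SemilatticeInf S] [Nonempty S] (hI : IsCompatible S) (h : FiniteExtension S) :
    IsGenericMeetSemilattice S := by
  classical
  refine ⟨?_, ?_⟩
  · rw [isUltrahomogeneous_iff_IsExtensionPair cg_of_countable,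
      isExtensionPair_iff_exists_embedding_closure_singleton_sup]
    intro N hN f m
    let N' := Substructure.closure meetLanguage {m} ⊔ N
    have hN' : N'.FG := (Substructure.fg_closure_singleton m).sup hN
    have hle : N ≤ N' := le_sup_right
    obtain ⟨e', he', heq⟩ := h S N N' (fun x => if h : x ∈ N then f ⟨x, h⟩ else x)
      (hI.finite_of_fg hN') (hI.infClosed N) (hI.infClosed N') hle
      ⟨fun a (ha : a ∈ N) b (hb : b ∈ N) hab => by
        simp only [ha, hb, dif_pos] at hab
        exact congrArg Subtype.val (f.injective hab),
      fun a (ha : a ∈ N) b (hb : b ∈ N) => by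
        have hab : a ⊓ b ∈ N := hI.infClosed N ha hb
        simp only [ha, hb, hab, dif_pos]
        refine Eq.trans (congrArg f ?_) ((map_meetOp f ⟨a, ha⟩ ⟨b, hb⟩).trans (hI _ _).2)
        exact Subtype.ext (((map_meetOp N.subtype ⟨a, ha⟩ ⟨b, hb⟩).trans (hI a b).2).symm)⟩
    let _ : SemilatticeInf N' := Subtype.semilatticeInf fun {x y} hx hy => hI.infClosed N' hx hy
    have hcN : IsCompatible N' := fun x y =>
      ⟨(map_ltRel N'.subtype x y).symm.trans (hI x y).1,
        Subtype.ext ((map_meetOp N'.subtype x y).trans (hI x y).2)⟩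
    refine ⟨hcN.toEmbedding hI (fun x => e' x)
      ⟨fun a _ b _ hab => Subtype.ext (he'.1 a.2 b.2 hab), fun a _ b _ => he'.2 _ a.2 _ b.2⟩, ?_⟩
    ext x
    have := heq x.2
    simp only [SetLike.mem_coe.1 x.2, dif_pos] at this
    exact this.symm
  · ext N
    constructor
    · rintro ⟨hN, ⟨g⟩⟩
      refine ⟨?_, IsMeetSemilattice.of_embedding ⟨_, hI⟩ g⟩
      have := (hI.finite_of_fg (hN.range g.toHom)).to_subtype
      exact Finite.of_injective _ g.equivRange.injective
    · rintro ⟨hN, hN'⟩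
      obtain ⟨_, hc⟩ := exists_isCompatible hN'
      obtain ⟨e, he, -⟩ := h N ∅ Set.univ (fun _ => Classical.arbitrary S) Set.finite_univ
        infClosed_empty infClosed_univ (Set.empty_subset _)
        ⟨fun _ h => h.elim, fun _ h => h.elim⟩
      exact ⟨FG.of_finite, ⟨hc.toEmbedding hI e he⟩⟩

section Step

variable (P : Type) [SemilatticeInf P]

/-- Codes `(u, l)` for new points: the point is to lie below the elements above `u`, and above the
elements of `l`. -/
abbrev PointCode : Type := WithTop P × Finset P

variable {P}

/-- The set representing an old point. -/
def oldPoint (p : P) : Set (P ⊕ PointCode P) :=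
  {y | Sum.elim (fun q => q ≤ p) (fun i => i.1 ≤ (p : WithTop P)) y}

/-- The set representing a new point. -/
def newPoint (i : PointCode P) : Set (P ⊕ PointCode P) :=
  {y | y = Sum.inr i ∨ ∃ l ∈ i.2, y ∈ oldPoint l}

theorem oldPoint_inf (p q : P) : oldPoint (p ⊓ q) = oldPoint p ⊓ oldPoint q := by
  ext (y | i)
  · exact le_inf_iff
  · change i.1 ≤ ((p ⊓ q : P) : WithTop P) ↔ _
    rw [WithTop.coe_inf]
    exact le_inf_iff

theorem inl_mem_oldPoint {p q : P} : Sum.inl q ∈ oldPoint p ↔ q ≤ p := Iff.rfl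

theorem inr_mem_oldPoint {p : P} {i : PointCode P} : Sum.inr i ∈ oldPoint p ↔ i.1 ≤ p := Iff.rfl

theorem oldPoint_subset {p q : P} : oldPoint p ⊆ oldPoint q ↔ p ≤ q := by
  refine ⟨fun h => h (inl_mem_oldPoint.2 le_rfl), fun h => ?_⟩
  refine Set.inter_eq_left.1 ((oldPoint_inf p q).symm.trans ?_)
  rw [inf_eq_left.2 h]

variable (P)

/-- The meet-semilattice generated by old and new points. -/
def PointExtension : Type :=
  infClosure (Set.range (oldPoint (P := P)) ∪ Set.range (newPoint (P := P)))

instance : SemilatticeInf (PointExtension P) :=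
  Subtype.semilatticeInf fun {_ _} hx hy => infClosed_infClosure hx hy

instance [Countable P] : Countable (PointExtension P) := by
  classical
  have : (Set.range (oldPoint (P := P)) ∪ Set.range (newPoint (P := P))).Countable :=
    (Set.countable_range _).union (Set.countable_range _)
  have := Set.countable_ofPred_finite_subset this
  refine (Set.Countable.mono ?_ (this.image fun s => ⋂₀ s)).to_subtype
  rintro _ ⟨t, ht, hts, rfl⟩
  refine ⟨t, ⟨t.finite_toSet, hts⟩, ?_⟩
  rw [Finset.inf'_eq_inf, Finset.inf_id_eq_sInf]
  rfl

variable {P}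

/-- The inclusion of the old points. -/
def toExtension (p : P) : PointExtension P :=
  ⟨oldPoint p, subset_infClosure (Or.inl ⟨p, rfl⟩)⟩

theorem infEmbOn_toExtension : InfEmbOn Set.univ (toExtension (P := P)) := by
  refine ⟨fun p _ q _ h => ?_, fun p _ q _ => Subtype.ext (oldPoint_inf p q)⟩
  have h : oldPoint p = oldPoint q := congrArg Subtype.val h
  exact le_antisymm (oldPoint_subset.1 h.subset) (oldPoint_subset.1 h.superset)

theorem exists_realizes_toExtension {T : Type*} [SemilatticeInf T] {A : Set T}
    (hA : A.Finite) {e : T → P} {w : T} (cA : InfClosed A) (cw : InfClosed (insert w A))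
    (hw : w ∉ A) (he : InfEmbOn A e) : ∃ x, Realizes A (toExtension ∘ e) w x := by
  classical
  let F := hA.toFinset
  have hF : ∀ a, a ∈ F ↔ a ∈ A := fun a => hA.mem_toFinset
  let u : WithTop P := (F.filter (w ≤ ·)).inf fun a => ((e a : P) : WithTop P)
  let i : PointCode P := (u, (F.filter (· ≤ w)).image e)
  have hu : u = ⊤ ∨ ∃ a ∈ A, w ≤ a ∧ u = e a := by
    refine Finset.inf_induction (p := fun u : WithTop P => u = ⊤ ∨ ∃ a ∈ A, w ≤ a ∧ u = e a) (Or.inl rfl) ?_ ?_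
    · rintro _ (rfl | ⟨a, ha, hwa, rfl⟩) _ (rfl | ⟨b, hb, hwb, rfl⟩)
      · simp
      · exact Or.inr ⟨b, hb, hwb, by simp⟩
      · exact Or.inr ⟨a, ha, hwa, by simp⟩
      · exact Or.inr ⟨a ⊓ b, cA ha hb, le_inf hwa hwb, by
          rw [he.2 a ha b hb, WithTop.coe_inf]⟩
    · intro a ha
      rw [Finset.mem_filter, hF] at ha
      exact Or.inr ⟨a, ha.1, ha.2, rfl⟩
  have hi : ∀ a ∈ A, (Sum.inr i ∈ oldPoint (e a) ↔ w ≤ a) := by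
    intro a ha
    rw [inr_mem_oldPoint]
    constructor
    · intro h
      change u ≤ _ at h
      rcases hu with hu | ⟨b, hb, hwb, hu⟩
      · rw [hu] at h
        exact absurd h (not_le_of_gt (WithTop.coe_lt_top _))
      · rw [hu, WithTop.coe_le_coe, he.le_iff cA hb ha] at h
        exact hwb.trans h
    · intro h
      exact Finset.inf_le (f := fun a => ((e a : P) : WithTop P))
        (Finset.mem_filter.2 ⟨(hF a).2 ha, h⟩)
  have hmem : ∀ y, y ∈ newPoint i ↔ y = Sum.inr i ∨ ∃ l ∈ A, l ≤ w ∧ y ∈ oldPoint (e l) := by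
    intro y
    refine or_congr_right ⟨?_, ?_⟩
    · rintro ⟨_, hl, hy⟩
      obtain ⟨l, hl', rfl⟩ := Finset.mem_image.1 hl
      rw [Finset.mem_filter, hF] at hl'
      exact ⟨l, hl'.1, hl'.2, hy⟩
    · rintro ⟨l, hl, hlw, hy⟩
      exact ⟨e l, Finset.mem_image.2 ⟨l, Finset.mem_filter.2 ⟨(hF l).2 hl, hlw⟩, rfl⟩, hy⟩
  refine ⟨⟨newPoint i, subset_infClosure (Or.inr ⟨i, rfl⟩)⟩, fun a ha => ⟨?_, ?_, ?_⟩⟩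
  · intro H
    have H : newPoint i = oldPoint (e a) := congrArg Subtype.val H
    have hwa : w ≤ a := (hi a ha).1 (H ▸ (hmem _).2 (Or.inl rfl))
    have : Sum.inl (e a) ∈ newPoint i := by rw [H, inl_mem_oldPoint]
    obtain h | ⟨l, hl, hlw, h⟩ := (hmem _).1 this
    · cases h
    · rw [inl_mem_oldPoint, he.le_iff cA ha hl] at h
      exact hw (le_antisymm hwa (h.trans hlw) ▸ ha)
  · intro hwa y hy
    rcases (hmem y).1 hy with rfl | ⟨l, hl, hlw, h⟩
    · exact (hi a ha).2 hwa
    · exact oldPoint_subset.2 ((he.le_iff cA hl ha).2 (hlw.trans hwa)) h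
  · intro hwa
    have hm : w ⊓ a ∈ A := by
      rcases cw (Set.mem_insert w A) (Set.mem_insert_of_mem w ha) with h | h
      · exact absurd (inf_eq_left.1 h) hwa
      · exact h
    refine Subtype.ext (Set.Subset.antisymm ?_ ?_)
    · rintro y ⟨hy, hya⟩
      rcases (hmem y).1 hy with rfl | ⟨l, hl, hlw, h⟩
      · exact absurd ((hi a ha).1 hya) hwa
      · have h' : y ∈ oldPoint (e l ⊓ e a) := by rw [oldPoint_inf]; exact ⟨h, hya⟩
        rw [← he.2 l hl a ha] at h'
        exact oldPoint_subset.2 ((he.le_iff cA (cA hl ha) hm).2 (inf_le_inf_right a hlw)) h'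
    · intro y hy
      exact ⟨(hmem y).2 (Or.inr ⟨w ⊓ a, hm, inf_le_left, hy⟩),
        oldPoint_subset.2 ((he.le_iff cA hm ha).2 inf_le_right) hy⟩

end Step

section Limit

/-- A countable meet-semilattice on a type in `Type`. -/
structure CountableSemilattice where
  carrier : Type
  [inst : SemilatticeInf carrier]
  [countable : Countable carrier]

attribute [instance] CountableSemilattice.inst CountableSemilattice.countable

/-- The sequence of iterated extensions of a one-point semilattice. -/
def extensionSeq : ℕ → CountableSemilattice
  | 0 => ⟨Unit⟩
  | n + 1 => ⟨PointExtension (extensionSeq n).carrier⟩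

/-- The stages of the construction of the generic meet-semilattice. -/
abbrev Stage (n : ℕ) : Type := (extensionSeq n).carrier

instance (n : ℕ) : meetLanguage.Structure (Stage n) := meetStructure (Stage n)

theorem isCompatible_stage (n : ℕ) : IsCompatible (Stage n) := isCompatible_meetStructure _

/-- The inclusion of a stage in the next one. -/
def stageStep (n : ℕ) : Stage n ↪[meetLanguage] Stage (n + 1) :=
  (isCompatible_stage n).toEmbedding (isCompatible_stage (n + 1))
    (toExtension (P := Stage n)) infEmbOn_toExtension

/-- The limit of the stages. -/
abbrev StageLimit : Type := FirstOrder.Language.DirectLimit Stage (DirectedSystem.natLERec stageStep)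

/-- The inclusion of a stage in the limit. -/
noncomputable def stageInclusion (n : ℕ) : Stage n ↪[meetLanguage] StageLimit :=
  FirstOrder.Language.DirectLimit.of meetLanguage ℕ Stage (DirectedSystem.natLERec stageStep) n

theorem stageInclusion_step (n : ℕ) (x : Stage n) :
    stageInclusion (n + 1) (stageStep n x) = stageInclusion n x := by
  have := FirstOrder.Language.DirectLimit.of_f (L := meetLanguage) (G := Stage)
    (f := DirectedSystem.natLERec stageStep) (hij := n.le_succ) (x := x)
  rw [stageInclusion, stageInclusion, ← this]
  congr 1
  rw [DirectedSystem.coe_natLERec]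
  exact (Nat.leRecOn_succ' (next := fun {k} => stageStep k) x).symm

theorem exists_stage {α : Type*} [Finite α] (x : α → StageLimit) :
    ∃ (n : ℕ) (y : α → Stage n), ∀ a, x a = stageInclusion n (y a) := by
  obtain ⟨n, y, h⟩ := FirstOrder.Language.DirectLimit.exists_quotient_mk'_sigma_mk'_eq Stage
    (DirectedSystem.natLERec stageStep) x
  exact ⟨n, y, fun a => congrFun h a⟩

theorem isMeetSemilattice_stageLimit : IsMeetSemilattice StageLimit :=
  isMeetSemilattice_of_local fun v => by
    obtain ⟨n, y, h⟩ := exists_stage v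
    exact ⟨Stage n, inferInstance, stageInclusion n, ⟨_, isCompatible_stage n⟩,
      fun i => ⟨y i, (h i).symm⟩⟩

instance : Countable StageLimit := by
  have : Function.Surjective fun p : Σ n, Stage n => stageInclusion p.1 p.2 := fun z => by
    obtain ⟨n, y, h⟩ := exists_stage fun _ : Unit => z
    exact ⟨⟨n, y ()⟩, (h ()).symm⟩
  exact this.countable

theorem isGenericMeetSemilattice_stageLimit : IsGenericMeetSemilattice StageLimit := by
  obtain ⟨_, hI⟩ := exists_isCompatible isMeetSemilattice_stageLimit
  have : Nonempty StageLimit := ⟨stageInclusion 0 ()⟩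
  refine FiniteExtension.isGenericMeetSemilattice hI (OnePointExtension.finiteExtension ?_)
  intro T _ _ A e w cA cw hw he
  obtain ⟨n, y, h⟩ := exists_stage e
  have hn := (isCompatible_stage n).infEmbOn hI (stageInclusion n)
  have hn' := (isCompatible_stage (n + 1)).infEmbOn hI (stageInclusion (n + 1))
  have hy : InfEmbOn A y := by
    refine ⟨fun a ha b hb hab => he.1 ha hb (by rw [h, h, hab]), fun a ha b hb => ?_⟩
    apply (stageInclusion n).injective
    rw [← h, he.2 a ha b hb, h, h, hn.2 _ trivial _ trivial]
  obtain ⟨x, hx⟩ := exists_realizes_toExtension A.toFinite cA cw hw hy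
  have h' : ∀ a, e a = stageInclusion (n + 1) (toExtension (y a)) := fun a => by
    rw [h]; exact (stageInclusion_step n (y a)).symm
  refine ⟨stageInclusion (n + 1) x, fun a ha => ?_⟩
  obtain ⟨h1, h2, h3⟩ := hx a ha
  rw [h', h']
  refine ⟨fun H => h1 ((stageInclusion (n + 1)).injective H), fun hwa => ?_, fun hwa => ?_⟩
  · exact (hn'.le_iff infClosed_univ trivial trivial).2 (h2 hwa)
  · exact (hn'.2 _ trivial _ trivial).symm.trans (congrArg _ (h3 hwa))

end Limit

universe u v w

open FirstOrder

section QFType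

variable {L : FirstOrder.Language.{u, v}} {M : Type w} [L.Structure M] {N : Type*} [L.Structure N]
  {α β : Type*}

theorem qfType_comp_embedding (g : M ↪[L] N) (a : α → M) : qfType L (g ∘ a) = qfType L a := by
  ext φ
  refine and_congr_right fun hφ => ?_
  have key : ∀ (n : ℕ) (φ : L.BoundedFormula α n) (xs : Fin n → M), φ.IsQF →
      (φ.Realize (g ∘ a) (g ∘ xs) ↔ φ.Realize a xs) := by
    intro n φ xs hφ
    induction hφ with
    | falsum => exact Iff.rfl
    | of_isAtomic h =>
      have ht : ∀ t : L.Term (α ⊕ Fin n),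
          t.realize (Sum.elim (g ∘ a) (g ∘ xs)) = g (t.realize (Sum.elim a xs)) := fun t => by
        rw [← Sum.comp_elim, HomClass.realize_term]
      cases h with
      | equal t t' => rw [BoundedFormula.realize_bdEqual, BoundedFormula.realize_bdEqual, ht, ht,
          g.injective.eq_iff]
      | rel R ts =>
        rw [BoundedFormula.realize_rel, BoundedFormula.realize_rel]
        simp only [ht]
        exact g.map_rel R _
    | imp _ _ h₁ h₂ => simp only [BoundedFormula.realize_imp, h₁, h₂]
  have := key 0 φ default hφ
  rwa [Subsingleton.elim (g ∘ default) default] at this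

theorem qfType_comp_equiv (g : M ≃[L] N) (a : α → M) : qfType L (g ∘ a) = qfType L a :=
  qfType_comp_embedding g.toEmbedding a

theorem mem_closure_range_iff {a : α → M} {x : M} :
    x ∈ Substructure.closure L (Set.range a) ↔ ∃ t : L.Term α, t.realize a = x := by
  rw [Substructure.mem_closure_iff_exists_term]
  constructor
  · rintro ⟨t, rfl⟩
    choose c hc using fun y : Set.range a => y.2
    refine ⟨t.relabel c, ?_⟩
    rw [Term.realize_relabel]
    congr 1
    exact funext hc
  · rintro ⟨t, rfl⟩
    refine ⟨t.relabel fun i => ⟨a i, i, rfl⟩, ?_⟩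
    rw [Term.realize_relabel]
    rfl

/-- In an ultrahomogeneous structure, tuples with the same quantifier-free type are conjugate. -/
theorem exists_equiv_of_qfType_eq (hM : L.IsUltrahomogeneous M) [Finite α] {a b : α → M}
    (h : qfType L a = qfType L b) : ∃ g : M ≃[L] M, g ∘ a = b := by
  have hqf : ∀ φ : L.Formula α, BoundedFormula.IsQF φ → (φ.Realize a ↔ φ.Realize b) := by
    intro φ hφ
    have := Set.ext_iff.1 h φ
    exact ⟨fun H => (this.1 ⟨hφ, H⟩).2, fun H => (this.2 ⟨hφ, H⟩).2⟩
  have heq : ∀ t t' : L.Term α, t.realize a = t'.realize a ↔ t.realize b = t'.realize b := by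
    intro t t'
    rw [← Formula.realize_equal, ← Formula.realize_equal]
    exact hqf _ (BoundedFormula.IsAtomic.equal _ _).isQF
  have hrel : ∀ {n} (R : L.Relations n) (t : Fin n → L.Term α),
      RelMap R (fun i => (t i).realize a) ↔ RelMap R (fun i => (t i).realize b) := by
    intro n R t
    rw [← Formula.realize_rel, ← Formula.realize_rel]
    exact hqf _ (BoundedFormula.IsAtomic.rel _ _).isQF
  let P := Substructure.closure L (Set.range a)
  choose τ hτ using fun x : P => mem_closure_range_iff.1 x.2
  let f : P ↪[L] M :=
    { toFun := fun x => (τ x).realize b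
      inj' := fun x y hxy => Subtype.ext (by rw [← hτ x, ← hτ y, heq]; exact hxy)
      map_fun' := fun {n} F x => by
        have : (τ (funMap F x)).realize a = (Term.func F fun i => τ (x i)).realize a := by
          rw [hτ, Term.realize_func]
          simp only [hτ]
          rfl
        exact (heq _ _).1 this
      map_rel' := fun {n} R x => by
        refine (hrel R fun i => τ (x i)).symm.trans ?_
        simp only [hτ]
        rfl }
  obtain ⟨g, hg⟩ := hM P (Substructure.fg_closure (Set.finite_range a)) f
  refine ⟨g, funext fun i => ?_⟩
  have hi : a i ∈ P := Substructure.subset_closure ⟨i, rfl⟩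
  have h1 : f ⟨a i, hi⟩ = g (a i) := DFunLike.congr_fun hg ⟨a i, hi⟩
  have h2 : (τ ⟨a i, hi⟩).realize b = (Term.var i : L.Term α).realize b :=
    (heq _ _).1 (hτ ⟨a i, hi⟩)
  exact h1.symm.trans h2

theorem qfType_comp (σ : β → α) {a b : α → M} (hM : L.IsUltrahomogeneous M) [Finite α]
    (h : qfType L a = qfType L b) : qfType L (a ∘ σ) = qfType L (b ∘ σ) := by
  obtain ⟨g, rfl⟩ := exists_equiv_of_qfType_eq hM h
  exact (qfType_comp_equiv g (a ∘ σ)).symm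

end QFType

section Canonical

variable {L : FirstOrder.Language.{u, v}} {M : Type w} [L.Structure M]

/-- The symbol of the quantifier-free type of a tuple. -/
def canSymbol {n : ℕ} (hn : 0 < n) (a : Fin n → M) : (canLanguage L M).Relations n :=
  ⟨qfType L a, hn, a, rfl⟩

theorem exists_eq_canSymbol {n : ℕ} (R : (canLanguage L M).Relations n) :
    ∃ (hn : 0 < n) (a : Fin n → M), R = canSymbol hn a := by
  obtain ⟨p, hn, a, rfl⟩ := R
  exact ⟨hn, a, rfl⟩

theorem canSymbol_eq_iff {n : ℕ} {hn : 0 < n} {a b : Fin n → M} :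
    canSymbol (L := L) hn a = canSymbol hn b ↔ qfType L a = qfType L b :=
  Subtype.ext_iff

theorem relMap_canSymbol {n : ℕ} {hn : 0 < n} {a b : Fin n → M} :
    RelMap (canSymbol (L := L) hn a) b ↔ qfType L b = qfType L a := Iff.rfl

instance : IsEmpty ((canLanguage L M).Relations 0) :=
  ⟨fun R => absurd R.2.1 (lt_irrefl 0)⟩

/-- An embedding of `M` is an embedding of its canonical structure. -/
def canEmbedding (g : M ↪[L] M) : M ↪[canLanguage L M] M where
  toFun := g
  inj' := g.injective
  map_fun' := fun F => isEmptyElim F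
  map_rel' := fun R x => by
    change qfType L (g ∘ x) = R.1 ↔ qfType L x = R.1
    rw [qfType_comp_embedding]

/-- An automorphism of `M` is an automorphism of its canonical structure. -/
def canEquiv (g : M ≃[L] M) : M ≃[canLanguage L M] M where
  toEquiv := g.toEquiv
  map_fun' := fun F => isEmptyElim F
  map_rel' := fun R x => by
    change qfType L (g ∘ x) = R.1 ↔ qfType L x = R.1
    rw [qfType_comp_equiv]

theorem qfType_comp_of_canEmbedding {P : Type*} [(canLanguage L M).Structure P] {n : ℕ}
    (hn : 0 < n) (i j : P ↪[canLanguage L M] M) (x : Fin n → P) :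
    qfType L (i ∘ x) = qfType L (j ∘ x) := by
  rw [← relMap_canSymbol (hn := hn), i.map_rel, ← j.map_rel, relMap_canSymbol]

theorem isUltrahomogeneous_can (hM : L.IsUltrahomogeneous M) :
    (canLanguage L M).IsUltrahomogeneous M := by
  intro P hP f
  have hfin : Finite P := hP.finite
  obtain ⟨n, ⟨x⟩⟩ := Finite.exists_equiv_fin P
  rcases Nat.eq_zero_or_pos n with rfl | hn
  · exact ⟨FirstOrder.Language.Equiv.refl _ _, by ext p; exact (x p).elim0⟩
  · obtain ⟨g, hg⟩ := exists_equiv_of_qfType_eq hM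
      (qfType_comp_of_canEmbedding hn P.subtype f x.symm)
    refine ⟨canEquiv g, ?_⟩
    ext p
    have := congrFun hg (x p)
    simp only [Function.comp_apply, Equiv.symm_apply_apply] at this
    exact this.symm

/-- Universal sentences true in `Can M` hold in all models of its theory. -/
theorem realize_of_model {L : FirstOrder.Language.{u, v}} {M : Type w} [L.Structure M]
    {N : Type*} [L.Structure N] [N ⊨ L.completeTheory M] {n : ℕ} (φ : L.Formula (Fin n))
    (h : ∀ x : Fin n → M, φ.Realize x) (x : Fin n → N) : φ.Realize x := by
  let ψ : L.Sentence := (φ.relabel (Sum.inr : Fin n → Empty ⊕ Fin n)).iAlls (Fin n)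
  have hψ : ψ ∈ L.completeTheory M := by
    rw [mem_completeTheory]
    change Formula.Realize _ _
    rw [Formula.realize_iAlls]
    intro y
    rw [Formula.realize_relabel]
    exact h y
  have := Theory.realize_sentence_of_mem (M := N) (L.completeTheory M) hψ
  change Formula.Realize _ _ at this
  rw [Formula.realize_iAlls] at this
  have := this x
  rw [Formula.realize_relabel] at this
  exact this

/-- The formula saying that a tuple can be extended to a tuple with a given type. -/
noncomputable def extFormula {n : ℕ} (a : Fin (n + 1) → M) : (canLanguage L M).Formula (Fin n) :=
  ((canSymbol (L := L) n.succ_pos a).formula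
    (Fin.snoc (fun i => Term.var (Sum.inl i)) (Term.var (Sum.inr ())) :
      Fin (n + 1) → (canLanguage L M).Term (Fin n ⊕ Unit))).iExs Unit

theorem realize_extFormula {K : Type*} [(canLanguage L M).Structure K] {n : ℕ}
    {a : Fin (n + 1) → M} {y : Fin n → K} : (extFormula (L := L) a).Realize y ↔
      ∃ z, RelMap (canSymbol (L := L) n.succ_pos a) (Fin.snoc y z : Fin (n + 1) → K) := by
  have ht : ∀ z : Unit → K, (fun i => ((Fin.snoc (fun i => Term.var (Sum.inl i))
      (Term.var (Sum.inr ())) : Fin (n + 1) → (canLanguage L M).Term (Fin n ⊕ Unit)) i).realize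
        (Sum.elim y z)) = (Fin.snoc y (z ()) : Fin (n + 1) → K) := by
    intro z
    ext i
    induction i using Fin.lastCases with
    | last => simp
    | cast i => simp
  rw [extFormula, Formula.realize_iExs]
  simp only [Formula.realize_rel]
  constructor
  · rintro ⟨z, hz⟩
    rw [ht] at hz
    exact ⟨z (), hz⟩
  · rintro ⟨z, hz⟩
    refine ⟨fun _ => z, ?_⟩
    rw [ht]
    exact hz

section Model

variable {N : Type*} [(canLanguage L M).Structure N]
  [N ⊨ (canLanguage L M).completeTheory M]

theorem exists_relMap_of_model [∀ n, Finite ((canLanguage L M).Relations n)] {n : ℕ} (hn : 0 < n)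
    (x : Fin n → N) : ∃ a : Fin n → M, RelMap (canSymbol (L := L) hn a) x := by
  have := realize_of_model (M := M)
    (Formula.iSup fun R : (canLanguage L M).Relations n => R.formula fun i => Term.var i)
    (fun y => Formula.realize_iSup.2 ⟨canSymbol hn y, Formula.realize_rel.2 rfl⟩) x
  obtain ⟨R, h⟩ := Formula.realize_iSup.1 this
  obtain ⟨_, a, rfl⟩ := exists_eq_canSymbol R
  exact ⟨a, Formula.realize_rel.1 h⟩

theorem relMap_comp_of_model (hM : L.IsUltrahomogeneous M) {n m : ℕ} {hn : 0 < n} (hm : 0 < m)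
    (σ : Fin m → Fin n) {a : Fin n → M} {x : Fin n → N} (h : RelMap (canSymbol (L := L) hn a) x) :
    RelMap (canSymbol (L := L) hm (a ∘ σ)) (x ∘ σ) := by
  have := realize_of_model (M := M)
    (((canSymbol (L := L) hn a).formula fun i => Term.var i).imp
      ((canSymbol (L := L) hm (a ∘ σ)).formula fun i => Term.var (σ i)))
    (fun y => by
      rw [Formula.realize_imp, Formula.realize_rel, Formula.realize_rel]
      exact fun H => qfType_comp σ hM H) x
  rw [Formula.realize_imp, Formula.realize_rel, Formula.realize_rel] at this
  exact this h

theorem relMap_unique_of_model {n : ℕ} {R R' : (canLanguage L M).Relations n}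
    {x : Fin n → N} (h : RelMap R x) (h' : RelMap R' x) : R = R' := by
  by_contra hne
  have := realize_of_model (M := M)
    ((R.formula fun i => Term.var i).imp (R'.formula fun i => Term.var i).not)
    (fun y => by
      rw [Formula.realize_imp, Formula.realize_not, Formula.realize_rel, Formula.realize_rel]
      exact fun H H' => hne (Subtype.ext (H.symm.trans H'))) x
  rw [Formula.realize_imp, Formula.realize_not, Formula.realize_rel, Formula.realize_rel] at this
  exact this h h'

open Classical in
theorem eq_iff_of_model (hM : L.IsUltrahomogeneous M) {n : ℕ} {hn : 0 < n} {a : Fin n → M}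
    {x : Fin n → N} (h : RelMap (canSymbol (L := L) hn a) x) (i j : Fin n) :
    x i = x j ↔ a i = a j := by
  have eqM : ∀ y : Fin n → M, qfType L y = qfType L a → (y i = y j ↔ a i = a j) := by
    intro y hy
    obtain ⟨g, rfl⟩ := exists_equiv_of_qfType_eq hM hy
    exact g.injective.eq_iff.symm
  have := realize_of_model (M := M)
    (((canSymbol (L := L) hn a).formula fun i => Term.var i).imp
      (if a i = a j then (Term.var i).equal (Term.var j) else
        ((Term.var i).equal (Term.var j)).not)) (fun y => by
      rw [Formula.realize_imp, Formula.realize_rel]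
      intro H
      have := eqM y H
      split_ifs with hij
      · rw [Formula.realize_equal]; exact this.2 hij
      · rw [Formula.realize_not, Formula.realize_equal]; exact fun h => hij (this.1 h)) x
  rw [Formula.realize_imp, Formula.realize_rel] at this
  have := this h
  split_ifs at this with hij
  · rw [Formula.realize_equal] at this; exact ⟨fun _ => hij, fun _ => this⟩
  · rw [Formula.realize_not, Formula.realize_equal] at this
    exact ⟨fun h => (this h).elim, fun h => (hij h).elim⟩

theorem exists_snoc_of_model (hM : L.IsUltrahomogeneous M) {n : ℕ} {a : Fin (n + 1) → M}
    {x : Fin n → N} (h : ∀ hn : 0 < n, RelMap (canSymbol (L := L) hn (a ∘ Fin.castSucc)) x) :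
    ∃ y, RelMap (canSymbol (L := L) n.succ_pos a) (Fin.snoc x y : Fin (n + 1) → N) := by
  rcases Nat.eq_zero_or_pos n with rfl | hn
  · have := realize_of_model (M := M) (extFormula (L := L) a) (fun y => by
      refine realize_extFormula.2 ⟨a (Fin.last 0), ?_⟩
      rw [relMap_canSymbol]
      congr 1
      ext i
      induction i using Fin.lastCases with
      | last => exact Fin.snoc_last (α := fun _ => M) _ _
      | cast i => exact i.elim0) x
    exact realize_extFormula.1 this
  · have := realize_of_model (M := M)
      (((canSymbol (L := L) hn (a ∘ Fin.castSucc)).formula fun i => Term.var i).imp (extFormula a))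
      (fun y => by
        rw [Formula.realize_imp, Formula.realize_rel, realize_extFormula]
        intro H
        obtain ⟨g, hg⟩ := exists_equiv_of_qfType_eq hM (Eq.symm H)
        refine ⟨g (a (Fin.last n)), ?_⟩
        rw [relMap_canSymbol, ← qfType_comp_equiv g a]
        congr 1
        ext i
        induction i using Fin.lastCases with
        | last => simp
        | cast i => rw [Fin.snoc_castSucc]; exact (congrFun hg i).symm) x
    rw [Formula.realize_imp, Formula.realize_rel] at this
    exact realize_extFormula.1 (this (h hn))

end Model

end Canonical

section Categoricity

variable {L : FirstOrder.Language.{u, v}} {M : Type w} [L.Structure M]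

/-- Tuples of the same type in two models of the theory of `Can M` are isomorphic. -/
theorem exists_embedding_of_relMap (hM : L.IsUltrahomogeneous M) {N₁ N₂ : Type*}
    [(canLanguage L M).Structure N₁] [N₁ ⊨ (canLanguage L M).completeTheory M]
    [(canLanguage L M).Structure N₂] [N₂ ⊨ (canLanguage L M).completeTheory M]
    {n : ℕ} (hn : 0 < n) {a : Fin n → M} {x : Fin n → N₁} {y : Fin n → N₂}
    (hx : RelMap (canSymbol (L := L) hn a) x) (hy : RelMap (canSymbol (L := L) hn a) y)
    (P : (canLanguage L M).Substructure N₁) (hP : ∀ p ∈ P, ∃ i, x i = p) :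
    ∃ g : P ↪[canLanguage L M] N₂, ∀ (i : Fin n) (p : P), x i = p → g p = y i := by
  choose c hc using fun p : P => hP p p.2
  have hxy : ∀ i j, x i = x j ↔ y i = y j := fun i j =>
    (eq_iff_of_model hM hx i j).trans (eq_iff_of_model hM hy i j).symm
  refine ⟨{ toFun := fun p => y (c p)
            inj' := fun p q hpq => Subtype.ext (by
              rw [← hc p, ← hc q]; exact (hxy _ _).2 hpq)
            map_fun' := fun F => isEmptyElim F
            map_rel' := fun {m} R z => ?_ }, fun i p h => ?_⟩
  · obtain ⟨hm, -⟩ := exists_eq_canSymbol R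
    have h1 := relMap_comp_of_model hM hm (fun i => c (z i)) hx
    have h2 := relMap_comp_of_model hM hm (fun i => c (z i)) hy
    have hz : x ∘ (fun i => c (z i)) = fun i => (z i : N₁) := funext fun i => hc (z i)
    rw [hz] at h1
    constructor
    · intro h
      obtain rfl := relMap_unique_of_model h2 h
      exact h1
    · intro h
      obtain rfl := relMap_unique_of_model h1 h
      exact h2
  · exact (hxy _ _).1 ((hc p).trans h.symm)

variable [∀ n, Finite ((canLanguage L M).Relations n)]

theorem isExtensionPair_of_model (hM : L.IsUltrahomogeneous M) {N₁ N₂ : Type*}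
    [(canLanguage L M).Structure N₁] [N₁ ⊨ (canLanguage L M).completeTheory M]
    [(canLanguage L M).Structure N₂] [N₂ ⊨ (canLanguage L M).completeTheory M] :
    (canLanguage L M).IsExtensionPair N₁ N₂ := by
  rw [isExtensionPair_iff_exists_embedding_closure_singleton_sup]
  intro P hP f m
  have := hP.finite
  obtain ⟨n, ⟨e⟩⟩ := Finite.exists_equiv_fin P
  let x : Fin n → N₁ := fun i => e.symm i
  obtain ⟨a, ha⟩ := exists_relMap_of_model (L := L) (M := M) n.succ_pos
    (Fin.snoc x m : Fin (n + 1) → N₁)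
  have hx : (Fin.snoc x m : Fin (n + 1) → N₁) ∘ Fin.castSucc = x :=
    funext fun i => Fin.snoc_castSucc (α := fun _ => N₁) _ _ _
  have hfx : ∀ hn : 0 < n, RelMap (canSymbol (L := L) hn (a ∘ Fin.castSucc)) (f ∘ e.symm) := by
    intro hn
    have := relMap_comp_of_model hM hn Fin.castSucc ha
    rw [hx] at this
    rw [f.map_rel]
    exact this
  obtain ⟨y, hy⟩ := exists_snoc_of_model hM hfx
  obtain ⟨g, hg⟩ := exists_embedding_of_relMap hM n.succ_pos ha hy
    (Substructure.closure (canLanguage L M) {m} ⊔ P) (by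
      intro p hp
      rw [← Substructure.closure_eq P, ← Substructure.closure_union,
        Substructure.mem_closure_iff_of_isRelational] at hp
      rcases hp with hp | hp
      · exact ⟨Fin.last n, by rw [Fin.snoc_last]; exact hp.symm⟩
      · refine ⟨(e ⟨p, hp⟩).castSucc, ?_⟩
        rw [Fin.snoc_castSucc]
        simp [x])
  refine ⟨g, ?_⟩
  ext p
  have hp : (Fin.snoc x m : Fin (n + 1) → N₁) (e p).castSucc = p := by
    rw [Fin.snoc_castSucc]; simp [x]
  have := hg (e p).castSucc ⟨p, (le_sup_right : P ≤ _) p.2⟩ hp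
  rw [Fin.snoc_castSucc] at this
  simp only [Function.comp_apply, Equiv.symm_apply_apply] at this
  exact this.symm

theorem omegaCategorical_can [Countable M] [Infinite M] (hM : L.IsUltrahomogeneous M) :
    OmegaCategorical (canLanguage L M) M := by
  refine ⟨Cardinal.mk_eq_aleph0 M, fun N₁ N₂ h₁ h₂ => ?_⟩
  have : Countable N₁ := Cardinal.mk_le_aleph0_iff.1 h₁.le
  have : Countable N₂ := Cardinal.mk_le_aleph0_iff.1 h₂.le
  have : IsEmpty (canLanguage L M).Constants := inferInstanceAs (IsEmpty Empty)
  obtain ⟨f, -⟩ := equiv_between_cg (L := canLanguage L M) (M := N₁) (N := N₂) cg_of_countable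
    cg_of_countable default (isExtensionPair_of_model hM) (isExtensionPair_of_model hM)
  exact ⟨f⟩

end Categoricity

section Meet

/-- Terms denote meets of their variables. -/
theorem exists_realize_eq_inf' {S : Type*} [meetLanguage.Structure S] [SemilatticeInf S]
    (hI : IsCompatible S) {α : Type*} (t : meetLanguage.Term α) :
    ∃ (F : Finset α) (hF : F.Nonempty), ∀ a : α → S, t.realize a = F.inf' hF a := by
  classical
  induction t with
  | var i => exact ⟨{i}, Finset.singleton_nonempty i, fun a => by simp⟩
  | func f ts ih =>
    cases f
    obtain ⟨F, hF, h⟩ := ih 0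
    obtain ⟨G, hG, h'⟩ := ih 1
    refine ⟨F ∪ G, hF.mono Finset.subset_union_left, fun a => ?_⟩
    rw [Finset.inf'_union hF hG, ← h, ← h', ← (hI _ _).2]
    refine congrArg (funMap meetSymbol) (?_ : (fun i => (ts i).realize a) = _)
    ext i; fin_cases i <;> rfl

theorem finite_relations_can {S : Type*} [meetLanguage.Structure S] [SemilatticeInf S]
    (hI : IsCompatible S) (n : ℕ) : Finite ((canLanguage meetLanguage S).Relations n) := by
  classical
  let D : (Fin n → S) → Set (Finset (Fin n) × Finset (Fin n)) := fun a =>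
    {p | ∃ (h₁ : p.1.Nonempty) (h₂ : p.2.Nonempty), p.1.inf' h₁ a ≤ p.2.inf' h₂ a}
  have hD : ∀ a b, D a = D b → ∀ (F G : Finset (Fin n)) (hF : F.Nonempty) (hG : G.Nonempty),
      (F.inf' hF a ≤ G.inf' hG a ↔ F.inf' hF b ≤ G.inf' hG b) := by
    intro a b hab F G hF hG
    have : (F, G) ∈ D a ↔ (F, G) ∈ D b := by rw [hab]
    exact ⟨fun h => (this.1 ⟨hF, hG, h⟩).2.2, fun h => (this.2 ⟨hF, hG, h⟩).2.2⟩
  have key : ∀ a b : Fin n → S, D a = D b → qfType meetLanguage a = qfType meetLanguage b := by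
    intro a b hab
    have hle : ∀ t t' : meetLanguage.Term (Fin n ⊕ Fin 0),
        t.realize (Sum.elim a default) ≤ t'.realize (Sum.elim a default) ↔
        t.realize (Sum.elim b default) ≤ t'.realize (Sum.elim b default) := by
      intro t t'
      have hr : ∀ (t : meetLanguage.Term (Fin n ⊕ Fin 0)) (a : Fin n → S),
          t.realize (Sum.elim a default) =
            (t.relabel (Sum.elim id Fin.elim0)).realize a := by
        intro t a
        rw [Term.realize_relabel]
        congr 1
        ext (i | i)
        · rfl
        · exact i.elim0
      simp only [hr]
      obtain ⟨F, hF, h⟩ := exists_realize_eq_inf' hI (t.relabel (Sum.elim id Fin.elim0))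
      obtain ⟨G, hG, h'⟩ := exists_realize_eq_inf' hI (t'.relabel (Sum.elim id Fin.elim0))
      rw [h, h', h, h']
      exact hD a b hab F G hF hG
    ext φ
    refine and_congr_right fun hφ => ?_
    change BoundedFormula.Realize φ a default ↔ BoundedFormula.Realize φ b default
    induction hφ with
    | falsum => exact Iff.rfl
    | of_isAtomic h =>
      cases h with
      | equal t t' =>
        rw [BoundedFormula.realize_bdEqual, BoundedFormula.realize_bdEqual, le_antisymm_iff,
          le_antisymm_iff, hle, hle]
      | rel R ts =>
        cases R
        have hlt : ∀ a : Fin n → S, RelMap (L := meetLanguage) ltSymbol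
            (fun i => (ts i).realize (Sum.elim a default)) ↔
            (ts 0).realize (Sum.elim a default) < (ts 1).realize (Sum.elim a default) := by
          intro a
          rw [← (hI _ _).1]
          refine iff_of_eq (congrArg _ ?_)
          ext i; fin_cases i <;> rfl
        refine (hlt a).trans (Iff.trans ?_ (hlt b).symm)
        rw [lt_iff_le_not_ge, lt_iff_le_not_ge, hle, hle]
    | imp _ _ h₁ h₂ => rw [BoundedFormula.realize_imp, BoundedFormula.realize_imp, h₁, h₂]
  choose hn a ha using fun R : (canLanguage meetLanguage S).Relations n => exists_eq_canSymbol R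
  refine Finite.of_injective (fun R => D (a R)) fun R R' h => ?_
  rw [ha R, ha R', canSymbol_eq_iff]
  exact key _ _ h

variable {S : Type} [meetLanguage.Structure S] [SemilatticeInf S] (hI : IsCompatible S)
  (hS : meetLanguage.IsUltrahomogeneous S)

include hI hS

theorem inf_eq_of_qfType_eq {x y : Fin 3 → S} (h : qfType meetLanguage x = qfType meetLanguage y)
    (hx : x 0 ⊓ x 1 = x 2) : y 0 ⊓ y 1 = y 2 := by
  obtain ⟨g, rfl⟩ := exists_equiv_of_qfType_eq hS h
  have := hI.map_inf hI g.toEmbedding (x 0) (x 1)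
  rw [hx] at this
  exact this.symm

theorem not_galahProperty [Infinite S] {a b : S} (ha : a ⊓ b ≠ a) (hb : a ⊓ b ≠ b) :
    ¬ GalahProperty (canLanguage meetLanguage S) S := by
  intro h
  rcases h {a ⊓ b}ᶜ with ⟨T, hT, ⟨j⟩⟩ | ⟨T, hT, ⟨j⟩⟩
  · have mem : ∀ x, x ∈ T ↔ x ≠ a ⊓ b := fun x => by
      rw [← SetLike.mem_coe, hT]; rfl
    let i := T.subtype.comp j.toEmbedding
    have hi : ∀ x (hx : x ∈ T), i (j.symm ⟨x, hx⟩) = x := fun x hx => by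
      simp [i]
    let x : Fin 3 → S := ![j.symm ⟨a, (mem a).2 ha.symm⟩, j.symm ⟨b, (mem b).2 hb.symm⟩,
      j.symm ⟨a, (mem a).2 ha.symm⟩ ⊓ j.symm ⟨b, (mem b).2 hb.symm⟩]
    have := inf_eq_of_qfType_eq hI hS (x := x) (y := i ∘ x)
      (qfType_comp_of_canEmbedding (by norm_num) (Embedding.refl _ _) i x) rfl
    simp only [Function.comp_apply, x, Matrix.cons_val_zero, Matrix.cons_val_one,
      Matrix.cons_val_two, hi] at this
    exact (mem _).1 (j (x 2)).2 this.symm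
  · rw [compl_compl] at hT
    have hsub : Subsingleton T := ⟨fun x y => Subtype.ext ((hT x.2).trans (hT y.2).symm)⟩
    have := j.injective.subsingleton
    exact not_subsingleton S this

theorem not_locallyReplicable [Infinite S] {a b : S} (ha : a ⊓ b ≠ a) (hb : a ⊓ b ≠ b) :
    ¬ LocallyReplicable (canLanguage meetLanguage S) S := by
  intro h
  let A : (canLanguage meetLanguage S).Substructure S :=
    ⟨{a, b}, fun {n} F => isEmptyElim F⟩
  let a' : (A : Set S) := ⟨a, Or.inl rfl⟩
  let b' : (A : Set S) := ⟨b, Or.inr rfl⟩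
  let U : Set S := {x | qfTypeOver (canLanguage meetLanguage S) (A : Set S) x =
    qfTypeOver (canLanguage meetLanguage S) (A : Set S) (a ⊓ b)}
  have hU : U ⊆ {a ⊓ b} := by
    intro x hx
    let φ : (canLanguage meetLanguage S).Formula ((A : Set S) ⊕ Unit) :=
      (canSymbol (L := meetLanguage) (n := 3) (by norm_num) ![a, b, a ⊓ b]).formula
        ![Term.var (Sum.inl a'), Term.var (Sum.inl b'), Term.var (Sum.inr ())]
    have hφ : ∀ y, φ ∈ qfTypeOver (canLanguage meetLanguage S) (A : Set S) y ↔
        qfType meetLanguage ![a, b, y] = qfType meetLanguage ![a, b, a ⊓ b] := by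
      intro y
      refine (and_iff_right (BoundedFormula.IsAtomic.rel _ _).isQF).trans ?_
      rw [Formula.realize_rel, relMap_canSymbol]
      refine iff_of_eq (congrArg (qfType meetLanguage · = _) ?_)
      ext i; fin_cases i <;> rfl
    have : φ ∈ qfTypeOver (canLanguage meetLanguage S) (A : Set S) x := by
      rw [show qfTypeOver (canLanguage meetLanguage S) (A : Set S) x = _ from hx]
      exact (hφ _).2 rfl
    exact (inf_eq_of_qfType_eq hI hS ((hφ x).1 this).symm rfl).symm
  obtain ⟨T, hT, ⟨j⟩⟩ := h U (TopologicalSpace.isOpen_generateFrom_of_mem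
    ⟨A, Set.toFinite ({a, b} : Set S), a ⊓ b, fun h => h.elim ha hb, rfl⟩) ⟨a ⊓ b, rfl⟩
  have hsub : Subsingleton T :=
    ⟨fun x y => Subtype.ext ((hU (hT x.2)).trans (hU (hT y.2)).symm)⟩
  have := j.injective.subsingleton
  exact not_subsingleton S this

theorem not_strongAmalgamation {a b : S} (ha : a ⊓ b ≠ a) (hb : a ⊓ b ≠ b) :
    ¬ StrongAmalgamation ((canLanguage meetLanguage S).age S) := by
  intro h
  let A : (canLanguage meetLanguage S).Substructure S :=
    ⟨{a, b}, fun {n} F => isEmptyElim F⟩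
  let B : (canLanguage meetLanguage S).Substructure S :=
    ⟨{a, b, a ⊓ b}, fun {n} F => isEmptyElim F⟩
  have hAB : A ≤ B := fun x hx => hx.imp id fun h => Or.inl h
  have hA : A.FG := Substructure.fg_iff_finite.2 (Set.toFinite ({a, b} : Set S))
  have hB : B.FG := Substructure.fg_iff_finite.2 (Set.toFinite ({a, b, a ⊓ b} : Set S))
  let f : A ↪[canLanguage meetLanguage S] B := Substructure.inclusion hAB
  obtain ⟨C, g₀, g₁, ⟨-, ⟨k⟩⟩, hg, hr⟩ := h ⟨A, inferInstance⟩ ⟨B, inferInstance⟩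
    ⟨B, inferInstance⟩ f f (age.fg_substructure hA) (age.fg_substructure hB)
    (age.fg_substructure hB)
  let a' : A := ⟨a, Or.inl rfl⟩
  let b' : A := ⟨b, Or.inr rfl⟩
  let m : B := ⟨a ⊓ b, Or.inr (Or.inr rfl)⟩
  let x : Fin 3 → B := ![f a', f b', m]
  have key : ∀ g : B ↪[canLanguage meetLanguage S] C, k (g (f a')) ⊓ k (g (f b')) = k (g m) :=
    fun g => inf_eq_of_qfType_eq hI hS (x := B.subtype ∘ x) (y := k.comp g ∘ x)
      (qfType_comp_of_canEmbedding (by norm_num) B.subtype (k.comp g) x) rfl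
  have hgf : ∀ c : A, g₀ (f c) = g₁ (f c) := fun c => DFunLike.congr_fun hg c
  have h01 : g₀ m = g₁ m := by
    apply k.injective
    rw [← key g₀, ← key g₁, hgf, hgf]
  have hm : g₀ m ∈ Set.range g₀ ∩ Set.range g₁ := ⟨⟨m, rfl⟩, ⟨m, h01.symm⟩⟩
  rw [hr] at hm
  obtain ⟨c, hc⟩ := hm
  have hcm : f c = m := g₀.injective hc
  have hcm' : (c : S) = a ⊓ b := congrArg Subtype.val hcm
  rcases c.2 with h | h
  · exact ha (hcm'.symm.trans h)
  · exact hb (hcm'.symm.trans h)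

omit hS in
theorem infiniteSunflowerProperty_can [Countable S] (h : FiniteExtension S) :
    InfiniteSunflowerProperty (canLanguage meetLanguage S) S := by
  rintro k - X V _ hV ⟨i⟩
  obtain ⟨φ, hφ, c, hc⟩ := h.exists_embedding_sunflower k (fun x => (i x : Finset X))
    (fun x => hV _ (i x).2)
  let j : S ↪[canLanguage meetLanguage S] V :=
    i.toEmbedding.comp (canEmbedding (hI.toEmbedding hI φ hφ))
  have hj : ∀ x, j x = i (φ x) := fun _ => rfl
  refine ⟨j.toHom.range, ⟨j.equivRange⟩, c, ?_⟩
  rintro _ ⟨x, rfl⟩ _ ⟨y, rfl⟩ hxy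
  exact hc x y fun h => hxy (by rw [h])

end Meet

end Sunflower

theorem propositionp :
    (∃ (S : Type) (_ : Sunflower.meetLanguage.Structure S) (_ : Countable S),
      Sunflower.IsGenericMeetSemilattice S) ∧
    ∀ (S : Type) [Sunflower.meetLanguage.Structure S] [Countable S],
      Sunflower.IsGenericMeetSemilattice S →
        Infinite S ∧
        Sunflower.OmegaCategorical (Sunflower.canLanguage Sunflower.meetLanguage S) S ∧
        (Sunflower.canLanguage Sunflower.meetLanguage S).IsUltrahomogeneous S ∧
        Sunflower.InfiniteSunflowerProperty (Sunflower.canLanguage Sunflower.meetLanguage S) S ∧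
        ¬ Sunflower.StrongAmalgamation
          ((Sunflower.canLanguage Sunflower.meetLanguage S).age S) ∧
        ¬ Sunflower.GalahProperty (Sunflower.canLanguage Sunflower.meetLanguage S) S ∧
        ¬ Sunflower.LocallyReplicable (Sunflower.canLanguage Sunflower.meetLanguage S) S ∧
        ¬ List.TFAE
          [Sunflower.InfiniteSunflowerProperty (Sunflower.canLanguage Sunflower.meetLanguage S) S,
            Sunflower.InfiniteKSunflowerProperty
              (Sunflower.canLanguage Sunflower.meetLanguage S) S 2,
            Sunflower.MonochromaticOrHeterochromatic
              (Sunflower.canLanguage Sunflower.meetLanguage S) S,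
            Sunflower.GalahProperty (Sunflower.canLanguage Sunflower.meetLanguage S) S,
            Sunflower.LocallyReplicable (Sunflower.canLanguage Sunflower.meetLanguage S) S] := by
  refine ⟨⟨Sunflower.StageLimit, inferInstance, inferInstance,
    Sunflower.isGenericMeetSemilattice_stageLimit⟩, fun S _ _ hS => ?_⟩
  have hU := hS.ultrahomogeneous
  obtain ⟨_, hI, _, hF⟩ := hS.exists_finiteExtension
  have hinf := hF.infinite
  have := fun n => Sunflower.finite_relations_can hI n
  obtain ⟨a, b, ha, hb⟩ := hF.exists_inf_ne
  have hsun := Sunflower.infiniteSunflowerProperty_can hI hF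
  have hgal := Sunflower.not_galahProperty hI hU ha hb
  exact ⟨hinf, Sunflower.omegaCategorical_can hU, Sunflower.isUltrahomogeneous_can hU, hsun,
    Sunflower.not_strongAmalgamation hI hU ha hb, hgal,
    Sunflower.not_locallyReplicable hI hU ha hb, fun h => hgal ((h.out 0 3).1 hsun)⟩
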